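/- There is an absolute constant $C>0$ such that the following holds for all integers $d\ge 2$, all points $x,\mu_y,\mu_z\in\mathbb{R}^d$ and all $\sigma>0$. Let $y$ and $z$ be independent random points with $y\sim\mathcal{N}_d(\mu_y,\sigma^2 I)$ and $z\sim\mathcal{N}_d(\mu_z,\sigma^2 I)$. Put $R=\|x-y\|$, $S=\|x-z\|$, $\bar r=\|x-\mu_y\|$, $\bar s=\|x-\mu_z\|$, and let $\phi\in[0,\pi]$ be the angle between $y-x$ and $z-x$. Then $\phi$ has a conditional density given $(R,S)$ with a version $f_{\phi\mid R=r,S=s}(\varphi)$ that is continuous in $(\varphi,r,s)\in[0,\pi]\times(0,\infty)\times(0,\infty)$, and every such continuous version satisfies, for all $r,s>0$, \[ \sup_{\varphi\in[0,\pi]} f_{\phi\mid R=r,S=s}(\varphi)\;\le\; C\left(\sqrt d+\frac{\sqrt{\min\{r\bar r,\,s\bar s\}}}{\sigma}\right). \] Moreover, if $d\ge 3$, then for all $r,s>0$ \[ \sup_{\varphi\in(0,\pi)} \frac{f_{\phi\mid R=r,S=s}(\varphi)}{\sin\varphi}\;\le\; C\left(\sqrt d+\frac{\min\{r\bar r,\,s\bar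 s\}}{\sigma^2\sqrt d}\right). \] -/

import Mathlib

open MeasureTheory ProbabilityTheory

/-- `f φ w`, for `φ ∈ I` and `w ∈ D`, is the continuous version of the conditional density of the
real random variable `Φ` (with values in `I`) given `W = w`: it is nonnegative, jointly continuous
on `I × D`, and disintegrates the joint law of `(Φ, W)` over the law of `W`. The conditional
density is in general only determined up to null sets; continuity on `I × D` fixes its value at
every point as soon as the law of `W` charges all nonempty open subsets of `D` (and `I` is a
nondegenerate interval). -/
structure IsContinuousCondDensity {Ω : Type*} [MeasurableSpace Ω] (P : Measure Ω)
    (Φ : Ω → ℝ) (W : Ω → ℝ × ℝ) (I : Set ℝ) (D : Set (ℝ × ℝ)) (f : ℝ → ℝ × ℝ → ℝ) : Prop where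
  nonneg : ∀ φ ∈ I, ∀ w ∈ D, 0 ≤ f φ w
  continuousOn : ContinuousOn (Function.uncurry f) (I ×ˢ D)
  measure_eq : ∀ (A : Set (ℝ × ℝ)) (B : Set ℝ), MeasurableSet A → MeasurableSet B →
    P {ω | W ω ∈ A ∧ Φ ω ∈ B} = ∫⁻ w in A, (∫⁻ φ in B ∩ I, ENNReal.ofReal (f φ w)) ∂(P.map W)

/-- The Gaussian distribution on `ℝᵈ` with mean `μ` and covariance matrix `σ² · 1`. -/
noncomputable def isotropicGaussian {d : ℕ} (μ : EuclideanSpace ℝ (Fin d)) (σ : ℝ) :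
    Measure (EuclideanSpace ℝ (Fin d)) :=
  multivariateGaussian μ (σ ^ 2 • (1 : Matrix (Fin d) (Fin d) ℝ))

/-- `f φ (r, s)` is the (continuous) density at `φ ∈ [0, π]` of the angle at `x` between `Y - x`
and `Z - x`, conditioned on `‖x - Y‖ = r` and `‖x - Z‖ = s`, for `r, s > 0`. -/
def IsCondAngleDensity {Ω : Type*} [MeasurableSpace Ω] (P : Measure Ω) {d : ℕ}
    (x : EuclideanSpace ℝ (Fin d)) (Y Z : Ω → EuclideanSpace ℝ (Fin d))
    (f : ℝ → ℝ × ℝ → ℝ) : Prop :=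
  IsContinuousCondDensity P (fun ω => InnerProductGeometry.angle (Y ω - x) (Z ω - x))
    (fun ω => (‖x - Y ω‖, ‖x - Z ω‖)) (Set.Icc 0 Real.pi) (Set.Ioi 0 ×ˢ Set.Ioi 0) f

/-! Write `d = m + 2`. Fix the direction `u` of `y - x` and the radii, and use polar coordinates for
`z - x` around the axis `u`. Put `b = (μ_z - x)/σ²`. Integrating out the directions orthogonal to
`u` leaves an angular density proportional to `sin^m φ · exp (a cos φ) · J (τ sin φ)`. Here `(a, τ)`
is `s` times the parallel and orthogonal parts of `b`, and `J` is the Laplace transform of a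
coordinate on a sphere (`lintegral_norm_angle_exp`). Both `|a|` and `τ` are at most `κ = s‖b‖ = s
s̄/σ²`, whatever `u` is. The conditional density given the radii is an average of such normalised
kernels over `u`. Hence any bound of a kernel by a multiple of its own integral, uniform in `u`,
passes to the density (`angleNumerator_le_mul_normalizer`).

The kernel bound is a Laplace-type argument at the maximum `φ₀`, which a reflection puts in `[0,
π/2]`. First-order terms cancel there, and the logarithm of the kernel falls by at most `4 (κ + m)
δ²` at `φ₀ + δ` (`angularKernel_ge_right`). So the kernel is comparable to its maximum on a window
of length about `(κ + m)^(-1/2)`, and the normalised kernel is at most of order `√(κ + m)`. For the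
quotient by `sin φ`, one power of the sine moves into the normalising integral. Stationarity keeps
the window away from `0`, so the sine is at least of order `√(m / (κ + m))` on part of it.

This gives both bounds in terms of `s s̄`; exchanging the two points gives `r r̄`, hence the
minimum. Every continuous version equals the explicit one because the law of the radii charges all
nonempty open subsets of the quadrant. -/

/-! ### Tilted Laplace transforms of bounded centred variables. -/

/-- A log-convex positive function `J` whose logarithmic derivative takes values in `[0, 1]` on
`[0, ∞)`. -/
structure IsTiltedLaplace (J : ℝ → ℝ) : Prop where
  pos : ∀ t, 0 < J t
  continuous : Continuous J
  tangent : ∀ t₀, 0 ≤ t₀ → ∃ L, 0 ≤ L ∧ L ≤ 1 ∧ HasDerivAt J (L * J t₀) t₀ ∧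
    ∀ t, J t₀ * Real.exp (L * (t - t₀)) ≤ J t

/-- The unnormalised angular density `sin^m φ · exp (a cos φ) · J (τ sin φ)`. -/
noncomputable def angularKernel (J : ℝ → ℝ) (m : ℕ) (a τ φ : ℝ) : ℝ :=
  Real.sin φ ^ m * Real.exp (a * Real.cos φ) * J (τ * Real.sin φ)

/-- The logarithmic derivative at `t` is the mean of `X` under the law tilted by `exp (t X)`: it is
at most `1` since `|X| ≤ 1`, and nonnegative for `t ≥ 0` since `X exp (t X) ≥ X` and `X` is centred.
The tangent inequality is Jensen's: integrate `exp (δ (X - L)) ≥ 1 + δ (X - L)` against the tilted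
law, whose mean is `L`. -/
theorem isTiltedLaplace_integral {α : Type*} [MeasurableSpace α] (ν : Measure α)
    [IsFiniteMeasure ν] (hν : ν ≠ 0) (X : α → ℝ) (hX : Measurable X) (hb : ∀ w, |X w| ≤ 1)
    (h0 : ∫ w, X w ∂ν = 0) : IsTiltedLaplace (fun t => ∫ w, Real.exp (t * X w) ∂ν) := by
  have hint : ∀ t, Integrable (fun w => Real.exp (t * X w)) ν := by
    intro t
    refine Integrable.of_bound (C := Real.exp |t|) (by fun_prop) (ae_of_all _ fun w => ?_)
    rw [Real.norm_eq_abs, Real.abs_exp, Real.exp_le_exp]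
    calc t * X w ≤ |t * X w| := le_abs_self _
      _ = |t| * |X w| := abs_mul _ _
      _ ≤ |t| * 1 := by gcongr; exact hb w
      _ = |t| := mul_one _
  have hint' : ∀ t, Integrable (fun w => X w * Real.exp (t * X w)) ν := by
    intro t
    refine (hint t).bdd_mul (c := 1) (by fun_prop) (ae_of_all _ fun w => ?_)
    simpa using hb w
  have hderiv : ∀ t, HasDerivAt (fun t => ∫ w, Real.exp (t * X w) ∂ν)
      (∫ w, X w * Real.exp (t * X w) ∂ν) t := by
    intro t
    have huniv : integrableExpSet X ν = Set.univ := by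
      ext t; simp [integrableExpSet, hint t]
    exact hasDerivAt_mgf (by simp [huniv])
  have hpos : ∀ t, 0 < ∫ w, Real.exp (t * X w) ∂ν := by
    intro t
    have : NeZero ν := ⟨hν⟩
    exact integral_exp_pos (hint t)
  refine ⟨hpos, continuous_iff_continuousAt.2 fun t => (hderiv t).continuousAt, ?_⟩
  intro t₀ ht₀
  set J₀ := ∫ w, Real.exp (t₀ * X w) ∂ν with hJ₀
  have hJpos : 0 < J₀ := hpos t₀
  set I := ∫ w, X w * Real.exp (t₀ * X w) ∂ν with hI
  have hLI : I / J₀ * J₀ = I := div_mul_cancel₀ _ hJpos.ne'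
  refine ⟨I / J₀, ?_, ?_, ?_, ?_⟩
  · refine div_nonneg ?_ hJpos.le
    rw [← h0, hI]
    have hXi : Integrable X ν := by simpa using hint' 0
    refine integral_mono hXi (hint' t₀) fun w => ?_
    rcases le_total 0 (X w) with h | h
    · have : 1 ≤ Real.exp (t₀ * X w) := Real.one_le_exp (mul_nonneg ht₀ h)
      change X w ≤ X w * _
      nlinarith
    · have : Real.exp (t₀ * X w) ≤ 1 := by
        rw [Real.exp_le_one_iff]; exact mul_nonpos_of_nonneg_of_nonpos ht₀ h
      change X w ≤ X w * _
      nlinarith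
  · rw [div_le_one hJpos]
    refine integral_mono (hint' t₀) (hint t₀) fun w => ?_
    have := (abs_le.1 (hb w)).2
    have h2 := Real.exp_pos (t₀ * X w)
    change X w * _ ≤ _
    nlinarith
  · rw [hLI]; exact hderiv t₀
  · intro t
    set L := I / J₀
    set δ := t - t₀
    have h1 : ∀ w, Real.exp (L * δ) * ((1 - δ * L) * Real.exp (t₀ * X w)
        + δ * (X w * Real.exp (t₀ * X w))) ≤ Real.exp (t * X w) := by
      intro w
      have e1 : Real.exp (t * X w) = Real.exp (L * δ) * (Real.exp (δ * (X w - L)) *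
          Real.exp (t₀ * X w)) := by
        rw [← Real.exp_add, ← Real.exp_add]; congr 1; simp only [δ]; ring
      rw [e1]
      have e2 := Real.add_one_le_exp (δ * (X w - L))
      have e3 := Real.exp_pos (t₀ * X w)
      refine mul_le_mul_of_nonneg_left ?_ (Real.exp_pos _).le
      nlinarith
    calc J₀ * Real.exp (L * δ) = Real.exp (L * δ) * ((1 - δ * L) * J₀ + δ * I) := by
          rw [← hLI]; ring
      _ = ∫ w, Real.exp (L * δ) * ((1 - δ * L) * Real.exp (t₀ * X w)
        + δ * (X w * Real.exp (t₀ * X w))) ∂ν := by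
          rw [integral_const_mul, integral_add ((hint t₀).const_mul _) ((hint' t₀).const_mul _),
            integral_const_mul, integral_const_mul]
      _ ≤ _ := integral_mono ((((hint t₀).const_mul _).add ((hint' t₀).const_mul _)).const_mul _)
          (hint t) h1

/-! ### Second-order trigonometric estimates. -/

section Trig

/-- Meant for `c = cot φ₀`, where the right side is `sin (φ₀ + δ) / sin φ₀`; the linear term `c δ`
must be exact so that it can cancel later. Taylor bounds give `1 + y` below the right side, and `log
(1 + y) ≥ y - 2 y²` for `y ≥ -1/2`. -/
theorem exp_sub_le_cos_add_mul_sin {c δ : ℝ} (hc : 0 ≤ c) (hδ : 0 ≤ δ) (hδ1 : δ ≤ 4 / 5) :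
    Real.exp (c * δ - 2 * (c ^ 2 + 1) * δ ^ 2) ≤ Real.cos δ + c * Real.sin δ := by
  have hcos : 1 - δ ^ 2 / 2 ≤ Real.cos δ := Real.one_sub_sq_div_two_le_cos
  have hsin : δ - δ ^ 3 / 6 ≤ Real.sin δ := by
    rcases hδ.eq_or_lt with rfl | h
    · simp
    · exact (Real.sin_gt_sub_cube h).le
  set y := c * δ - δ ^ 2 / 2 - c * δ ^ 3 / 6 with hy
  have hyle : 1 + y ≤ Real.cos δ + c * Real.sin δ := by nlinarith
  have hcd : 0 ≤ c * δ := mul_nonneg hc hδ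
  have hd2 : δ ^ 2 ≤ 16 / 25 := by nlinarith
  have hylow : -(1 / 2) ≤ y := by nlinarith
  have hypos : 0 < 1 + y := by linarith
  refine le_trans ?_ hyle
  rw [← Real.le_log_iff_exp_le hypos]
  have hlog : y - 2 * y ^ 2 ≤ Real.log (1 + y) := by
    refine le_trans ?_ (Real.one_sub_inv_le_log_of_pos hypos)
    rw [le_sub_iff_add_le, ← le_sub_iff_add_le', inv_le_iff_one_le_mul₀ hypos]
    nlinarith [mul_nonneg (sq_nonneg y) (by linarith : (0:ℝ) ≤ 1 + 2 * y)]
  refine le_trans ?_ hlog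
  set e := c * δ with he
  set q := δ ^ 2 with hq
  have hq0 : 0 ≤ q := sq_nonneg _
  have hyq : y = e - q / 2 - e * q / 6 := by rw [hy, he, hq]; ring
  have h1 : 2 * (c ^ 2 + 1) * q = 2 * e ^ 2 + 2 * q := by rw [he, hq]; ring
  rw [h1, hyq]
  have h2 : 0 ≤ e * q := mul_nonneg hcd hq0
  have h3 : 0 ≤ e ^ 2 * q := by positivity
  have h4 : e ^ 2 * q * q ≤ e ^ 2 * q * (16 / 25) := by gcongr
  have h5 : q * q ≤ q * (16 / 25) := by gcongr
  have h6 : e * q * q ≤ e * q * (16 / 25) := by gcongr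
  nlinarith

/-- A Taylor remainder with `5/8 = 1/2 + 1/8`, covering the increments of both `sin` and `cos` at a
base point with sine and cosine `S`, `C` up to sign and order. -/
theorem abs_add_increment_le {S C δ : ℝ} (hS : |S| ≤ 1) (hC : |C| ≤ 1) (hδ : 0 ≤ δ)
    (hδ1 : δ ≤ 3 / 4) :
    |C * Real.cos δ + S * Real.sin δ - C - S * δ| ≤ δ ^ 2 * (5 / 8) := by
  have hcos : 1 - δ ^ 2 / 2 ≤ Real.cos δ := Real.one_sub_sq_div_two_le_cos
  have hcos1 := Real.cos_le_one δ
  have hsin : δ - δ ^ 3 / 6 ≤ Real.sin δ := by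
    rcases hδ.eq_or_lt with rfl | h
    · simp
    · exact (Real.sin_gt_sub_cube h).le
  have hsin1 := Real.sin_le hδ
  have hδ3 : δ ^ 3 ≤ δ ^ 2 * (3 / 4) := by
    rw [pow_succ]; gcongr
  have e : C * Real.cos δ + S * Real.sin δ - C - S * δ =
    C * (Real.cos δ - 1) + S * (Real.sin δ - δ) := by ring
  have h1 : |Real.cos δ - 1| ≤ δ ^ 2 / 2 := by rw [abs_le]; constructor <;> linarith [sq_nonneg δ]
  have h2 : |Real.sin δ - δ| ≤ δ ^ 2 / 8 := by rw [abs_le]; constructor <;> linarith [sq_nonneg δ]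
  calc _ ≤ |C * (Real.cos δ - 1)| + |S * (Real.sin δ - δ)| := by rw [e]; exact abs_add_le _ _
    _ ≤ 1 * (δ ^ 2 / 2) + 1 * (δ ^ 2 / 8) := by rw [abs_mul, abs_mul]; gcongr
    _ = _ := by ring

end Trig

/-! ### Local behaviour of the angular kernel at its maximum. -/

section Kernel

variable {J : ℝ → ℝ} {m : ℕ} {a τ κ φ₀ : ℝ}

theorem angularKernel_nonneg (hJ : IsTiltedLaplace J) {φ : ℝ} (hφ : φ ∈ Set.Icc 0 Real.pi) :
    0 ≤ angularKernel J m a τ φ := by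
  have := Real.sin_nonneg_of_mem_Icc hφ
  have := hJ.pos (τ * Real.sin φ)
  unfold angularKernel
  positivity

theorem continuous_angularKernel (hJ : IsTiltedLaplace J) :
    Continuous (angularKernel J m a τ) := by
  have := hJ.continuous
  unfold angularKernel
  fun_prop

theorem angularKernel_pi_sub (φ : ℝ) :
    angularKernel J m a τ (Real.pi - φ) = angularKernel J m (-a) τ φ := by
  simp [angularKernel, Real.sin_pi_sub, Real.cos_pi_sub]

/-- At an interior maximum, the logarithmic derivative of the angular kernel vanishes. -/
theorem angularKernel_stationary (hpos : 0 < φ₀) (hpi : φ₀ < Real.pi)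
    (hmax : ∀ φ ∈ Set.Icc 0 Real.pi, angularKernel J m a τ φ ≤ angularKernel J m a τ φ₀)
    {L : ℝ} (hJpos : 0 < J (τ * Real.sin φ₀))
    (hL : HasDerivAt J (L * J (τ * Real.sin φ₀)) (τ * Real.sin φ₀)) :
    m * Real.cos φ₀ = (a * Real.sin φ₀ - L * τ * Real.cos φ₀) * Real.sin φ₀ := by
  have hsin : 0 < Real.sin φ₀ := Real.sin_pos_of_pos_of_lt_pi hpos hpi
  have hd1 := (Real.hasDerivAt_sin φ₀).pow m
  have hd2 := ((Real.hasDerivAt_cos φ₀).const_mul a).exp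
  have hd3 : HasDerivAt (fun φ => J (τ * Real.sin φ))
      (L * J (τ * Real.sin φ₀) * (τ * Real.cos φ₀)) φ₀ :=
    HasDerivAt.comp φ₀ hL ((Real.hasDerivAt_sin φ₀).const_mul τ)
  have hd := (hd1.mul hd2).mul hd3
  have hloc : IsLocalMax (angularKernel J m a τ) φ₀ := by
    filter_upwards [Icc_mem_nhds hpos hpi] with φ hφ using hmax φ hφ
  have h0 := hloc.hasDerivAt_eq_zero hd
  simp only [Pi.mul_apply, Pi.pow_apply] at h0
  set S := Real.sin φ₀
  set c := Real.cos φ₀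
  set j := J (τ * S)
  set E := Real.exp (a * c)
  have hE : 0 < E := Real.exp_pos _
  -- Multiplying by `S` removes the truncated exponent `m - 1`, so `m = 0` is covered too.
  have hpow : (m : ℝ) * S ^ (m - 1) * S = m * S ^ m := by
    rcases m with _ | m
    · simp
    · simp [pow_succ]; ring
  have h1 : (S ^ m * E * j) * (m * c - (a * S - L * τ * c) * S) = 0 := by
    have : (S ^ m * E * j) * (m * c - (a * S - L * τ * c) * S)
      = E * j * c * (m * S ^ m) - (S ^ m * E * j) * ((a * S - L * τ * c) * S) := by ring
    rw [this, ← hpow, ← zero_mul S, ← h0]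
    ring
  have h2 : S ^ m * E * j ≠ 0 := by positivity
  linarith [(mul_eq_zero.1 h1).resolve_left h2]

/-- At a maximum in `[0, π/2]`, the power of the sine has logarithmic slope `c`, which is balanced
by the slope of the other two factors. -/
theorem angularKernel_exists_slope (hJ : IsTiltedLaplace J) (ha : |a| ≤ κ) (hτ : 0 ≤ τ)
    (h0 : 0 ≤ φ₀) (h1 : φ₀ ≤ Real.pi / 2)
    (hmax : ∀ φ ∈ Set.Icc 0 Real.pi, angularKernel J m a τ φ ≤ angularKernel J m a τ φ₀)
    {L : ℝ} (hL0 : 0 ≤ L)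
    (hLd : HasDerivAt J (L * J (τ * Real.sin φ₀)) (τ * Real.sin φ₀)) :
    ∃ c : ℝ, 0 ≤ c ∧
      m * Real.cos φ₀ ≤ κ * Real.sin φ₀ ^ 2 ∧ m * c ^ 2 ≤ κ ∧
      (m ≠ 0 → Real.cos φ₀ = c * Real.sin φ₀) ∧
      a * Real.sin φ₀ - L * τ * Real.cos φ₀ ≤ m * c := by
  have hpi := Real.pi_pos
  have hκ : 0 ≤ κ := (abs_nonneg a).trans ha
  have hs0 : 0 ≤ Real.sin φ₀ := Real.sin_nonneg_of_mem_Icc ⟨h0, by linarith⟩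
  have hc0 : 0 ≤ Real.cos φ₀ := Real.cos_nonneg_of_mem_Icc ⟨by linarith, h1⟩
  have hmaxpos : 0 < angularKernel J m a τ φ₀ := by
    refine lt_of_lt_of_le ?_ (hmax (Real.pi / 2) ⟨by linarith, by linarith⟩)
    have := hJ.pos (τ * 1)
    simp only [angularKernel, Real.sin_pi_div_two]
    positivity
  have ha' := abs_le.1 ha
  have hc1 := Real.cos_le_one φ₀
  rcases h0.eq_or_lt with rfl | hpos
  -- The kernel is positive at `π/2`, hence at its maximum; at `φ₀ = 0` this forces `m = 0`, and the
  -- slope `c` plays no role.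
  · have hm : m = 0 := by
      by_contra hm
      simp [angularKernel, hm] at hmaxpos
    subst hm
    refine ⟨0, le_rfl, ?_, ?_, by simp, ?_⟩ <;> simp [hκ]
    exact mul_nonneg hL0 hτ
  · have hS : 0 < Real.sin φ₀ := Real.sin_pos_of_pos_of_lt_pi hpos (by linarith)
    have hst := angularKernel_stationary hpos (by linarith) hmax (hJ.pos _) hLd
    have hle : m * Real.cos φ₀ ≤ κ * Real.sin φ₀ ^ 2 := by
      rw [hst, sq, ← mul_assoc]
      refine mul_le_mul_of_nonneg_right ?_ hs0
      have := mul_nonneg (mul_nonneg hL0 hτ) hc0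
      nlinarith
    have hcS : Real.cos φ₀ = Real.cos φ₀ / Real.sin φ₀ * Real.sin φ₀ :=
      (div_mul_cancel₀ _ hS.ne').symm
    refine ⟨Real.cos φ₀ / Real.sin φ₀, by positivity, hle, ?_, fun _ => hcS, ?_⟩
    · rw [div_pow, ← mul_div_assoc, div_le_iff₀ (by positivity)]
      calc (m : ℝ) * Real.cos φ₀ ^ 2 = (m * Real.cos φ₀) * Real.cos φ₀ := by ring
        _ ≤ (κ * Real.sin φ₀ ^ 2) * 1 := by gcongr
        _ = _ := mul_one _
    · rw [← mul_div_assoc, le_div_iff₀ hS, hst]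

/-- Just to the right of a maximum in `[0, π/2]`, the angular kernel is bounded below by a
Gaussian profile; the maximum is not too close to `0`. -/
theorem angularKernel_ge_right (hJ : IsTiltedLaplace J) (ha : |a| ≤ κ) (hτ : 0 ≤ τ)
    (hτκ : τ ≤ κ) (h0 : 0 ≤ φ₀) (h1 : φ₀ ≤ Real.pi / 2)
    (hmax : ∀ φ ∈ Set.Icc 0 Real.pi, angularKernel J m a τ φ ≤ angularKernel J m a τ φ₀) :
    m * Real.cos φ₀ ≤ κ * Real.sin φ₀ ^ 2 ∧
    ∀ δ, 0 ≤ δ → δ ≤ 3 / 4 →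
      angularKernel J m a τ φ₀ * Real.exp (-(4 * (κ + m) * δ ^ 2)) ≤
        angularKernel J m a τ (φ₀ + δ) := by
  have hκ : 0 ≤ κ := (abs_nonneg a).trans ha
  have hs0 : 0 ≤ Real.sin φ₀ := Real.sin_nonneg_of_mem_Icc ⟨h0, by linarith⟩
  have hc0 : 0 ≤ Real.cos φ₀ := Real.cos_nonneg_of_mem_Icc ⟨by linarith, h1⟩
  obtain ⟨L, hL0, hL1, hLd, hLt⟩ := hJ.tangent (τ * Real.sin φ₀) (mul_nonneg hτ hs0)
  obtain ⟨c, hc, hmc, hmc2, hsc', hstat⟩ :=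
    angularKernel_exists_slope hJ ha hτ h0 h1 hmax hL0 hLd
  refine ⟨hmc, fun δ hδ hδ1 => ?_⟩
  have hK : 0 ≤ angularKernel J m a τ φ₀ :=
    angularKernel_nonneg hJ ⟨h0, by linarith [Real.pi_pos]⟩
  have hS1 := Real.abs_sin_le_one φ₀
  have hC1 := Real.abs_cos_le_one φ₀
  have hsp : 0 ≤ Real.sin (φ₀ + δ) :=
    Real.sin_nonneg_of_nonneg_of_le_pi (by linarith) (by linarith [Real.pi_gt_three])
  have hsinadd := Real.sin_add φ₀ δ
  have hcosadd := Real.cos_add φ₀ δ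
  set S := Real.sin φ₀
  set C := Real.cos φ₀
  -- the power of the sine
  have hpow : S ^ m * Real.exp (m * (c * δ - 2 * (c ^ 2 + 1) * δ ^ 2)) ≤
      Real.sin (φ₀ + δ) ^ m := by
    rcases eq_or_ne m 0 with rfl | hm
    · simp
    · have : Real.sin (φ₀ + δ) = S * (Real.cos δ + c * Real.sin δ) := by
        rw [hsinadd, hsc' hm]; ring
      rw [this, mul_pow, Real.exp_nat_mul]
      gcongr
      exact exp_sub_le_cos_add_mul_sin hc hδ (by linarith)
  -- the two exponential factors
  have herr1 : -(δ ^ 2 * (5 / 8)) * κ ≤ a * (C * Real.cos δ - S * Real.sin δ - C + S * δ) := by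
    have h : |C * Real.cos δ - S * Real.sin δ - C + S * δ| ≤ δ ^ 2 * (5 / 8) := by
      convert! abs_add_increment_le (S := -S) (C := C) (by rwa [abs_neg]) hC1 hδ hδ1 using 2
      ring
    have h2 : |a * (C * Real.cos δ - S * Real.sin δ - C + S * δ)| ≤ κ * (δ ^ 2 * (5 / 8)) := by
      rw [abs_mul]; gcongr
    linarith only [(abs_le.1 h2).1]
  have herr2 : -(δ ^ 2 * (5 / 8)) * κ ≤
      L * τ * (S * Real.cos δ + C * Real.sin δ - S - C * δ) := by
    have h : |S * Real.cos δ + C * Real.sin δ - S - C * δ| ≤ δ ^ 2 * (5 / 8) :=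
      abs_add_increment_le hC1 hS1 hδ hδ1
    have h2 : |L * τ * (S * Real.cos δ + C * Real.sin δ - S - C * δ)| ≤
        1 * κ * (δ ^ 2 * (5 / 8)) := by
      rw [abs_mul, abs_mul, abs_of_nonneg hL0, abs_of_nonneg hτ]; gcongr
    linarith only [(abs_le.1 h2).1]
  -- The linear terms sum to `(m c - (a S - L τ C)) δ ≥ 0` by the choice of `c`. The quadratic loss
  -- is at most `2 m c² + 2 m + 2 · (5/8) κ`, with `m c² ≤ κ`, which fits into `4 (κ + m)`.
  have hexp : -(4 * (κ + m) * δ ^ 2) ≤ m * (c * δ - 2 * (c ^ 2 + 1) * δ ^ 2) +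
      (a * Real.cos (φ₀ + δ) - a * C) + L * (τ * Real.sin (φ₀ + δ) - τ * S) := by
    rw [hsinadd, hcosadd]
    have e1 : m * c ^ 2 * δ ^ 2 ≤ κ * δ ^ 2 := by gcongr
    have e2 : (a * S - L * τ * C) * δ ≤ m * c * δ := by gcongr
    have e3 : 0 ≤ κ * δ ^ 2 := by positivity
    have e4 : 0 ≤ m * δ ^ 2 := by positivity
    linarith only [e1, e2, e3, e4, herr1, herr2]
  calc angularKernel J m a τ φ₀ * Real.exp (-(4 * (κ + m) * δ ^ 2))
      ≤ angularKernel J m a τ φ₀ * Real.exp (m * (c * δ - 2 * (c ^ 2 + 1) * δ ^ 2) +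
      (a * Real.cos (φ₀ + δ) - a * C) + L * (τ * Real.sin (φ₀ + δ) - τ * S)) := by gcongr
    _ = (S ^ m * Real.exp (m * (c * δ - 2 * (c ^ 2 + 1) * δ ^ 2))) *
        (Real.exp (a * C) * Real.exp (a * Real.cos (φ₀ + δ) - a * C)) *
        (J (τ * S) * Real.exp (L * (τ * Real.sin (φ₀ + δ) - τ * S))) := by
        rw [Real.exp_add, Real.exp_add]; simp only [angularKernel]; ring
    _ ≤ Real.sin (φ₀ + δ) ^ m * Real.exp (a * Real.cos (φ₀ + δ)) *
        J (τ * Real.sin (φ₀ + δ)) := by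
        rw [← Real.exp_add, add_sub_cancel]
        have := hJ.pos (τ * S)
        gcongr
        exact hLt _

end Kernel

/-! ### Bounding the kernel by its integral. -/

section KernelBounds

theorem mul_le_integral_zero_pi {g : ℝ → ℝ} (hg : Continuous g)
    (hg0 : ∀ φ ∈ Set.Icc 0 Real.pi, 0 ≤ g φ) {α β c : ℝ} (hα : 0 ≤ α) (hαβ : α ≤ β)
    (hβ : β ≤ Real.pi) (hc : ∀ φ ∈ Set.Icc α β, c ≤ g φ) :
    (β - α) * c ≤ ∫ φ in (0)..Real.pi, g φ := by
  calc (β - α) * c = ∫ _ in α..β, c := by simp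
    _ ≤ ∫ φ in α..β, g φ :=
      intervalIntegral.integral_mono_on hαβ (by simp) (hg.intervalIntegrable _ _) hc
    _ ≤ ∫ φ in (0)..Real.pi, g φ := by
      refine intervalIntegral.integral_mono_interval hα hαβ hβ ?_ (hg.intervalIntegrable _ _)
      exact (ae_restrict_mem measurableSet_Ioc).mono fun φ hφ => hg0 φ ⟨hφ.1.le, hφ.2⟩

variable {J : ℝ → ℝ} {m : ℕ} {a τ κ : ℝ}

/-- On a window of length `(κ + m + p)^(-1/2)` the Gaussian exponent is at most `4`. The condition
`p ≥ 2` makes the length at most `3/4`, as `16/9 ≤ 2`. -/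
theorem angularKernel_ge_exp_neg_four (hJ : IsTiltedLaplace J) (ha : |a| ≤ κ) (hτ : 0 ≤ τ)
    (hτκ : τ ≤ κ) {φ₀ p : ℝ} (hp : 2 ≤ p) (h0 : 0 ≤ φ₀) (h1 : φ₀ ≤ Real.pi / 2)
    (hmax : ∀ φ ∈ Set.Icc 0 Real.pi, angularKernel J m a τ φ ≤ angularKernel J m a τ φ₀) :
    (√(κ + m + p))⁻¹ ≤ 3 / 4 ∧ ∀ φ ∈ Set.Icc φ₀ (φ₀ + (√(κ + m + p))⁻¹),
      angularKernel J m a τ φ₀ * Real.exp (-4) ≤ angularKernel J m a τ φ := by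
  have hκ : 0 ≤ κ := hτ.trans hτκ
  have hm : (0 : ℝ) ≤ m := m.cast_nonneg
  have hN : 0 < κ + m + p := by linarith
  have hl : (√(κ + m + p))⁻¹ ≤ 3 / 4 := by
    rw [inv_le_comm₀ (Real.sqrt_pos.2 hN) (by norm_num)]
    apply Real.le_sqrt_of_sq_le
    norm_num; linarith
  refine ⟨hl, fun φ hφ => ?_⟩
  have h := (angularKernel_ge_right hJ ha hτ hτκ h0 h1 hmax).2 (φ - φ₀) (by linarith [hφ.1])
    (by linarith [hφ.2])
  rw [add_sub_cancel] at h
  refine le_trans ?_ h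
  have hk : 0 ≤ angularKernel J m a τ φ₀ :=
    angularKernel_nonneg hJ ⟨h0, by linarith [Real.pi_pos]⟩
  gcongr
  have hsq : (φ - φ₀) ^ 2 ≤ (κ + m + p)⁻¹ := by
    calc (φ - φ₀) ^ 2 ≤ ((√(κ + m + p))⁻¹) ^ 2 :=
          pow_le_pow_left₀ (by linarith [hφ.1]) (by linarith [hφ.2]) 2
      _ = _ := by rw [inv_pow, Real.sq_sqrt hN.le]
  calc 4 * (κ + m) * (φ - φ₀) ^ 2 ≤ 4 * (κ + m + p) * (κ + m + p)⁻¹ :=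
        mul_le_mul (by linarith) hsq (sq_nonneg _) (by positivity)
    _ = 4 := by field_simp

theorem angularKernel_exists_max (hJ : IsTiltedLaplace J) : ∃ φ₀ ∈ Set.Icc 0 Real.pi,
    ∀ φ ∈ Set.Icc 0 Real.pi, angularKernel J m a τ φ ≤ angularKernel J m a τ φ₀ :=
  isCompact_Icc.exists_isMaxOn ⟨0, le_rfl, Real.pi_pos.le⟩
    (continuous_angularKernel hJ).continuousOn

/-- The reflection `φ ↦ π - φ` replaces `a` by `-a`, keeping `|a| ≤ κ` and the symmetric weight `g`,
so only maxima in `[0, π/2]` need treatment. The weights used are `1` and `sin`. -/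
theorem angularKernel_le_of_max (hJ : IsTiltedLaplace J) (g : ℝ → ℝ)
    (hg : ∀ φ, g (Real.pi - φ) = g φ) {B : ℝ} (ha : |a| ≤ κ)
    (h : ∀ a φ₀, |a| ≤ κ → 0 ≤ φ₀ → φ₀ ≤ Real.pi / 2 →
      (∀ φ ∈ Set.Icc 0 Real.pi, angularKernel J m a τ φ ≤ angularKernel J m a τ φ₀) →
      angularKernel J m a τ φ₀ ≤ B * ∫ φ in (0)..Real.pi, angularKernel J m a τ φ * g φ)
    {φ : ℝ} (hφ : φ ∈ Set.Icc 0 Real.pi) :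
    angularKernel J m a τ φ ≤ B * ∫ φ in (0)..Real.pi, angularKernel J m a τ φ * g φ := by
  obtain ⟨φ₀, hφ₀, hmax⟩ := angularKernel_exists_max (m := m) (a := a) (τ := τ) hJ
  refine (hmax φ hφ).trans ?_
  rcases le_total φ₀ (Real.pi / 2) with h1 | h1
  · exact h a φ₀ ha hφ₀.1 h1 hmax
  · have h2 := h (-a) (Real.pi - φ₀) (by rwa [abs_neg]) (by linarith [hφ₀.2]) (by linarith)
      (fun φ hφ => by
        rw [← angularKernel_pi_sub, ← angularKernel_pi_sub, sub_sub_cancel]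
        exact hmax _ ⟨by linarith [hφ.2], by linarith [hφ.1]⟩)
    rw [← angularKernel_pi_sub, sub_sub_cancel] at h2
    refine h2.trans_eq ?_
    congr 1
    have := intervalIntegral.integral_comp_sub_left (a := 0) (b := Real.pi)
      (fun φ => angularKernel J m a τ φ * g φ) Real.pi
    simp only [sub_self, sub_zero, angularKernel_pi_sub, hg] at this
    exact this

theorem angularKernel_le_sqrt_mul_integral (hJ : IsTiltedLaplace J) (ha : |a| ≤ κ) (hτ : 0 ≤ τ)
    (hτκ : τ ≤ κ) {φ : ℝ} (hφ : φ ∈ Set.Icc 0 Real.pi) :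
    angularKernel J m a τ φ ≤
      Real.exp 4 * √(κ + m + 2) * ∫ φ in (0)..Real.pi, angularKernel J m a τ φ := by
  have key := angularKernel_le_of_max (κ := κ) (m := m) (a := a) (τ := τ) hJ (fun _ => 1)
    (fun _ => rfl) (B := Real.exp 4 * √(κ + m + 2)) ha ?_ hφ
  · simpa using key
  intro a φ₀ ha h0 h1 hmax
  simp only [mul_one]
  obtain ⟨hl, hge⟩ := angularKernel_ge_exp_neg_four hJ ha hτ hτκ (le_refl (2 : ℝ)) h0 h1 hmax
  have hN : 0 < √(κ + m + 2) := Real.sqrt_pos.2 (by positivity [hτ.trans hτκ])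
  have hl0 : 0 < (√(κ + m + 2))⁻¹ := inv_pos.2 hN
  have := mul_le_integral_zero_pi (continuous_angularKernel (m := m) (a := a) (τ := τ) hJ)
    (fun φ hφ => angularKernel_nonneg hJ hφ) h0 (by linarith)
    (by linarith [Real.pi_gt_three]) hge
  calc angularKernel J m a τ φ₀ = Real.exp 4 * √(κ + m + 2) *
      ((φ₀ + (√(κ + m + 2))⁻¹ - φ₀) * (angularKernel J m a τ φ₀ * Real.exp (-4))) := by
        rw [Real.exp_neg]; field_simp; ring
    _ ≤ _ := by gcongr

/-- If `cos φ₀ ≤ 1/2`, then `sin φ₀ ≥ 1/2` while `√(m + 3) ℓ ≤ 1`. Otherwise `m ≤ 2 κ sin² φ₀`, so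
`sin φ₀` is at least of order `√m ℓ`, and the shift `δ ≥ ℓ/2` accounts for the summand `3`, even
when `φ₀ = 0`. -/
theorem mul_div_le_sin_add {φ₀ κ m ℓ δ : ℝ} (hκ : 0 ≤ κ) (hm : 0 ≤ m) (h0 : 0 ≤ φ₀)
    (h1 : φ₀ ≤ Real.pi / 2) (hcs : m * Real.cos φ₀ ≤ κ * Real.sin φ₀ ^ 2) (hl0 : 0 < ℓ)
    (hl : ℓ ≤ 3 / 4) (hℓ2 : ℓ ^ 2 * (κ + m + 3) = 1) (hδ1 : ℓ / 2 ≤ δ) (hδ2 : δ ≤ ℓ) :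
    √(m + 3) * ℓ / 16 ≤ Real.sin (φ₀ + δ) := by
  have hpi := Real.pi_gt_three
  have hM2 : √(m + 3) ^ 2 = m + 3 := Real.sq_sqrt (by positivity)
  have hs0 : 0 ≤ Real.sin φ₀ := Real.sin_nonneg_of_mem_Icc ⟨h0, by linarith⟩
  have hc0 : 0 ≤ Real.cos φ₀ := Real.cos_nonneg_of_mem_Icc ⟨by linarith, h1⟩
  have hsc := Real.sin_sq_add_cos_sq φ₀
  have hcosδ : 1 / 2 ≤ Real.cos δ := by
    have := Real.one_sub_sq_div_two_le_cos (x := δ)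
    nlinarith
  have hsinδ : δ / 2 ≤ Real.sin δ := by
    have := Real.mul_le_sin (x := δ) (by linarith) (by linarith)
    refine le_trans ?_ this
    rw [div_eq_inv_mul]
    gcongr
    · linarith
    · rw [le_div_iff₀ (by linarith)]; linarith [Real.pi_lt_four]
  rw [Real.sin_add]
  have h2 : Real.sin φ₀ / 2 + Real.cos φ₀ * (ℓ / 4) ≤
      Real.sin φ₀ * Real.cos δ + Real.cos φ₀ * Real.sin δ := by
    have e1 : Real.sin φ₀ * (1 / 2) ≤ Real.sin φ₀ * Real.cos δ := by gcongr
    have e2 : Real.cos φ₀ * (ℓ / 4) ≤ Real.cos φ₀ * Real.sin δ := by gcongr; linarith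
    linarith
  refine le_trans ?_ h2
  have hsq : (√(m + 3) * ℓ) ^ 2 = (m + 3) * ℓ ^ 2 := by rw [mul_pow, hM2]
  rcases le_total (Real.cos φ₀) (1 / 2) with hc | hc
  · have : √(m + 3) * ℓ ≤ 1 := by
      rw [← sq_le_one_iff₀ (by positivity), hsq]
      have := mul_nonneg (sq_nonneg ℓ) hκ
      linarith
    have : 1 / 2 ≤ Real.sin φ₀ := by nlinarith
    have : 0 ≤ Real.cos φ₀ * (ℓ / 4) := by positivity
    linarith
  · have e1 : Real.sin φ₀ / 2 + ℓ / 8 ≤ Real.sin φ₀ / 2 + Real.cos φ₀ * (ℓ / 4) := by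
      nlinarith
    refine le_trans ?_ e1
    refine le_of_sq_le_sq ?_ (by positivity)
    have e2 : m * ℓ ^ 2 ≤ 2 * Real.sin φ₀ ^ 2 := by
      have : m ≤ 2 * κ * Real.sin φ₀ ^ 2 := by nlinarith
      have e3 : κ * ℓ ^ 2 ≤ 1 := by nlinarith [sq_nonneg ℓ]
      calc m * ℓ ^ 2 ≤ 2 * κ * Real.sin φ₀ ^ 2 * ℓ ^ 2 := by gcongr
        _ = 2 * Real.sin φ₀ ^ 2 * (κ * ℓ ^ 2) := by ring
        _ ≤ 2 * Real.sin φ₀ ^ 2 * 1 := by gcongr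
        _ = _ := mul_one _
    rw [div_pow, hsq]
    nlinarith [mul_nonneg hs0 hl0.le]

/-- This serves the quotient by `sin φ`: the kernel has one power of the sine less than the
normalising integrand. On the right half of the window, of length `ℓ/2`, the sine is at least `√(m +
3) ℓ / 16`, whence the factor `32`. -/
theorem angularKernel_le_mul_integral_mul_sin (hJ : IsTiltedLaplace J) (ha : |a| ≤ κ)
    (hτ : 0 ≤ τ) (hτκ : τ ≤ κ) {φ : ℝ} (hφ : φ ∈ Set.Icc 0 Real.pi) :
    angularKernel J m a τ φ ≤ 32 * Real.exp 4 * ((κ + m + 3) / √(m + 3)) *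
      ∫ φ in (0)..Real.pi, angularKernel J m a τ φ * Real.sin φ := by
  refine angularKernel_le_of_max (κ := κ) hJ Real.sin Real.sin_pi_sub ha ?_ hφ
  intro a φ₀ ha h0 h1 hmax
  have hκ : 0 ≤ κ := hτ.trans hτκ
  have hm : (0 : ℝ) ≤ m := m.cast_nonneg
  have hpi := Real.pi_gt_three
  obtain ⟨hl, hge⟩ :=
    angularKernel_ge_exp_neg_four hJ ha hτ hτκ (by norm_num : (2 : ℝ) ≤ 3) h0 h1 hmax
  have hcs := (angularKernel_ge_right hJ ha hτ hτκ h0 h1 hmax).1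
  have hN : 0 < √(κ + m + 3) := Real.sqrt_pos.2 (by positivity)
  have hM : 0 < √((m : ℝ) + 3) := Real.sqrt_pos.2 (by positivity)
  set ℓ := (√(κ + m + 3))⁻¹ with hℓ
  have hl0 : 0 < ℓ := inv_pos.2 hN
  have hℓ2 : ℓ ^ 2 * (κ + m + 3) = 1 := by
    rw [hℓ, inv_pow, Real.sq_sqrt (by positivity)]
    exact inv_mul_cancel₀ (by positivity)
  set k₀ := angularKernel J m a τ φ₀
  have hk₀ : 0 ≤ k₀ := angularKernel_nonneg hJ ⟨h0, by linarith⟩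
  have hsin : ∀ φ ∈ Set.Icc (φ₀ + ℓ / 2) (φ₀ + ℓ), √((m : ℝ) + 3) * ℓ / 16 ≤ Real.sin φ := by
    intro φ hφ
    rw [← add_sub_cancel φ₀ φ]
    exact mul_div_le_sin_add hκ hm h0 h1 hcs hl0 hl hℓ2 (by linarith [hφ.1]) (by linarith [hφ.2])
  have hint := mul_le_integral_zero_pi
    ((continuous_angularKernel (m := m) (a := a) (τ := τ) hJ).mul Real.continuous_sin)
    (fun φ hφ => mul_nonneg (angularKernel_nonneg hJ hφ) (Real.sin_nonneg_of_mem_Icc hφ))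
    (c := k₀ * Real.exp (-4) * (√((m : ℝ) + 3) * ℓ / 16))
    (α := φ₀ + ℓ / 2) (β := φ₀ + ℓ) (by linarith) (by linarith)
    (by linarith) (fun φ hφ =>
      mul_le_mul (hge φ ⟨by linarith [hφ.1], hφ.2⟩) (hsin φ hφ) (by positivity)
        (angularKernel_nonneg hJ ⟨by linarith [hφ.1], by linarith [hφ.2]⟩))
  calc k₀ = 32 * Real.exp 4 * ((κ + m + 3) / √(m + 3)) *
      ((φ₀ + ℓ - (φ₀ + ℓ / 2)) * (k₀ * Real.exp (-4) * (√((m : ℝ) + 3) * ℓ / 16))) := by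
        have : k₀ = k₀ * (ℓ ^ 2 * (κ + m + 3)) := by rw [hℓ2, mul_one]
        conv_lhs => rw [this]
        rw [Real.exp_neg]; field_simp; ring
    _ ≤ _ := by gcongr; exact hint

end KernelBounds

/-! ### Lebesgue density of the isotropic Gaussian. -/

section GaussianDensity

open scoped MatrixOrder

theorem charFun_isotropicGaussian {d : ℕ} (μ : EuclideanSpace ℝ (Fin d)) (σ : ℝ)
    (t : EuclideanSpace ℝ (Fin d)) :
    charFun (isotropicGaussian μ σ) t =
      Complex.exp ((inner ℝ t μ : ℝ) * Complex.I - (σ ^ 2 * ‖t‖ ^ 2 : ℝ) / 2) := by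
  rw [isotropicGaussian, charFun_multivariateGaussian]
  · congr 3
    rw [Matrix.smul_mulVec, Matrix.one_mulVec, dotProduct_smul, EuclideanSpace.real_norm_sq_eq]
    simp [dotProduct, sq]
  · exact Matrix.PosSemidef.one.smul (sq_nonneg σ)

theorem integrable_exp_neg_mul_sq_norm_sub {V : Type*} [NormedAddCommGroup V]
    [InnerProductSpace ℝ V] [FiniteDimensional ℝ V] [MeasurableSpace V] [BorelSpace V]
    {b : ℝ} (hb : 0 < b) (μ : V) : Integrable (fun v : V => Real.exp (-b * ‖v - μ‖ ^ 2)) := by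
  have h := GaussianFourier.integrable_cexp_neg_mul_sq_norm_add (V := V) (b := b)
    (by simpa using hb) 0 0
  have h2 := (h.norm).comp_sub_right μ
  refine h2.congr (ae_of_all _ fun v => ?_)
  simp [Complex.norm_exp, ← Complex.ofReal_pow]

theorem integral_exp_mul_gaussian {V : Type*} [NormedAddCommGroup V]
    [InnerProductSpace ℝ V] [FiniteDimensional ℝ V] [MeasurableSpace V] [BorelSpace V]
    {b : ℝ} (hb : 0 < b) (μ t : V) :
    ∫ v : V, Complex.exp ((inner ℝ v t : ℝ) * Complex.I) * (Real.exp (-b * ‖v - μ‖ ^ 2) : ℝ) =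
      (Real.pi / b : ℂ) ^ (Module.finrank ℝ V / 2 : ℂ) *
        Complex.exp ((inner ℝ t μ : ℝ) * Complex.I - (‖t‖ ^ 2 : ℝ) / (4 * b)) := by
  rw [← integral_add_right_eq_self _ μ]
  have h := GaussianFourier.integral_cexp_neg_mul_sq_norm_add (V := V) (b := b)
    (by simpa using hb) Complex.I t
  calc _ = ∫ v : V, Complex.exp ((inner ℝ t μ : ℝ) * Complex.I) *
        Complex.exp (-b * ‖v‖ ^ 2 + Complex.I * (inner ℝ t v : ℝ)) := by
        congr 1 with v
        rw [add_sub_cancel_right, Complex.ofReal_exp, ← Complex.exp_add, ← Complex.exp_add,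
          inner_add_left, real_inner_comm v, real_inner_comm μ]
        congr 1; push_cast; ring
    _ = _ := by
        rw [integral_const_mul, h, mul_left_comm, ← Complex.exp_add]
        congr 2
        rw [Complex.I_sq]; push_cast; ring

/-- Two finite measures with equal characteristic functions coincide. Only the positivity of `c` is
recorded, since it cancels in the conditional density. -/
theorem exists_isotropicGaussian_eq_withDensity {d : ℕ} (μ : EuclideanSpace ℝ (Fin d)) {σ : ℝ}
    (hσ : 0 < σ) : ∃ c : ℝ, 0 < c ∧ isotropicGaussian μ σ = volume.withDensity
      (fun v => ENNReal.ofReal (c * Real.exp (-(2 * σ ^ 2)⁻¹ * ‖v - μ‖ ^ 2))) := by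
  set b := (2 * σ ^ 2)⁻¹ with hbdef
  have hb : 0 < b := by positivity
  have hint := integrable_exp_neg_mul_sq_norm_sub hb μ
  set c : ℝ := ((Real.pi / b) ^ (d / 2 : ℝ))⁻¹ with hcdef
  have hc : 0 < c := by positivity
  refine ⟨c, hc, ?_⟩
  have hfin : IsFiniteMeasure ((volume : Measure (EuclideanSpace ℝ (Fin d))).withDensity
      (fun v => ENNReal.ofReal (c * Real.exp (-b * ‖v - μ‖ ^ 2)))) :=
    isFiniteMeasure_withDensity_ofReal (hint.const_mul c).2
  have : IsFiniteMeasure (isotropicGaussian μ σ) := by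
    unfold isotropicGaussian; infer_instance
  apply Measure.ext_of_charFun
  ext t
  rw [charFun_isotropicGaussian, charFun_apply,
    integral_withDensity_eq_integral_toReal_smul (by fun_prop) (by simp)]
  have hcc : (c : ℂ) * (Real.pi / b : ℂ) ^ (d / 2 : ℂ) = 1 := by
    have : (Real.pi / b : ℂ) ^ (d / 2 : ℂ) = (((Real.pi / b) ^ (d / 2 : ℝ) : ℝ) : ℂ) := by
      rw [Complex.ofReal_cpow (by positivity)]; push_cast; rfl
    rw [this, ← Complex.ofReal_mul, hcdef, inv_mul_cancel₀ (by positivity), Complex.ofReal_one]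
  calc _ = ((c : ℂ) * (Real.pi / b : ℂ) ^ (d / 2 : ℂ)) *
        Complex.exp ((inner ℝ t μ : ℝ) * Complex.I - (‖t‖ ^ 2 : ℝ) / (4 * b)) := by
        rw [hcc, one_mul]
        congr 2
        have : (b : ℂ) = (2 * (σ : ℂ) ^ 2)⁻¹ := by rw [hbdef]; push_cast; rfl
        rw [this]
        have : (σ : ℂ) ≠ 0 := by exact_mod_cast hσ.ne'
        push_cast; field_simp; ring
    _ = (c : ℂ) * ∫ v : EuclideanSpace ℝ (Fin d), Complex.exp ((inner ℝ v t : ℝ) * Complex.I) *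
          (Real.exp (-b * ‖v - μ‖ ^ 2) : ℝ) := by
        rw [integral_exp_mul_gaussian hb μ t, finrank_euclideanSpace_fin, mul_assoc]
    _ = _ := by
        rw [← integral_const_mul]
        congr 1 with v
        rw [ENNReal.toReal_ofReal (by positivity), Complex.real_smul]
        push_cast; ring

end GaussianDensity

/-! ### Polar coordinates in a normed space and in the half-plane. -/

section Polar

open Set Metric

theorem lintegral_eq_lintegral_toSphere {E : Type*} [NormedAddCommGroup E] [NormedSpace ℝ E]
    [MeasurableSpace E] [BorelSpace E] [FiniteDimensional ℝ E] [Nontrivial E]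
    (μ : Measure E) [μ.IsAddHaarMeasure] {G : E → ENNReal} (hG : Measurable G) :
    ∫⁻ y, G y ∂μ = ∫⁻ r in Ioi (0 : ℝ), ENNReal.ofReal (r ^ (Module.finrank ℝ E - 1)) *
      ∫⁻ u : sphere (0 : E) 1, G (r • (u : E)) ∂μ.toSphere := by
  have hmp := μ.measurePreserving_homeomorphUnitSphereProd
  have hH : Measurable fun p : sphere (0 : E) 1 × Ioi (0 : ℝ) => G ((p.2 : ℝ) • (p.1 : E)) :=
    hG.comp (by fun_prop)
  have hm : Measurable fun r : ℝ => ∫⁻ u : sphere (0 : E) 1, G (r • (u : E)) ∂μ.toSphere := by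
    refine Measurable.lintegral_prod_right' (f := fun p : ℝ × sphere (0 : E) 1 =>
      G (p.1 • (p.2 : E))) (hG.comp (by fun_prop))
  calc ∫⁻ y, G y ∂μ = ∫⁻ y in ({0}ᶜ : Set E), G y ∂μ := by rw [restrict_compl_singleton]
    _ = ∫⁻ y : ({0}ᶜ : Set E), G y ∂(μ.comap (↑)) :=
      (lintegral_subtype_comap (measurableSet_singleton _).compl _).symm
    _ = ∫⁻ p : sphere (0 : E) 1 × Ioi (0 : ℝ), G ((p.2 : ℝ) • (p.1 : E))
        ∂(μ.toSphere.prod (Measure.volumeIoiPow (Module.finrank ℝ E - 1))) := by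
      rw [← hmp.lintegral_comp hH]
      refine lintegral_congr fun y => ?_
      have := (homeomorphUnitSphereProd E).symm_apply_apply y
      conv_lhs => rw [← this]
      rfl
    _ = ∫⁻ r : Ioi (0 : ℝ), ∫⁻ u : sphere (0 : E) 1, G ((r : ℝ) • (u : E)) ∂μ.toSphere
        ∂(Measure.volumeIoiPow (Module.finrank ℝ E - 1)) := lintegral_prod_symm' _ hH
    _ = _ := by
      rw [Measure.volumeIoiPow, lintegral_withDensity_eq_lintegral_mul _ (by fun_prop)
        (g := fun r : Ioi (0 : ℝ) => ∫⁻ u : sphere (0 : E) 1, G ((r : ℝ) • (u : E)) ∂μ.toSphere)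
        (hm.comp measurable_subtype_coe)]
      exact lintegral_subtype_comap measurableSet_Ioi (fun r : ℝ =>
        ENNReal.ofReal (r ^ (Module.finrank ℝ E - 1)) *
      ∫⁻ u : sphere (0 : E) 1, G (r • (u : E)) ∂μ.toSphere)

/-- Here `x` will be the component along the axis and `ρ` the distance to the axis. Extending `G` by
zero to the plane makes the usual polar coordinates applicable; the sign of the sine then selects
`(0, π)`. -/
theorem lintegral_upper_half_plane_polar {G : ℝ × ℝ → ENNReal} (hG : Measurable G) :
    ∫⁻ x : ℝ, ∫⁻ ρ in Ioi (0 : ℝ), G (x, ρ) =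
      ∫⁻ s in Ioi (0 : ℝ), ∫⁻ φ in Ioo 0 Real.pi,
        ENNReal.ofReal s * G (s * Real.cos φ, s * Real.sin φ) := by
  set G' : ℝ × ℝ → ENNReal := (univ ×ˢ Ioi (0 : ℝ)).indicator G with hG'
  have hms : MeasurableSet ((univ : Set ℝ) ×ˢ Ioi (0 : ℝ)) := by measurability
  have hmG' : Measurable G' := hG.indicator hms
  have hmp : Measurable fun p : ℝ × ℝ => ENNReal.ofReal p.1 * G' (polarCoord.symm p) := by
    refine Measurable.mul (by fun_prop) (hmG'.comp ?_)
    exact continuous_polarCoord_symm.measurable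
  have h1 : ∫⁻ x : ℝ, ∫⁻ ρ in Ioi (0 : ℝ), G (x, ρ) = ∫⁻ p, G' p := by
    rw [Measure.volume_eq_prod, lintegral_prod _ hmG'.aemeasurable]
    refine lintegral_congr fun x => ?_
    rw [← lintegral_indicator measurableSet_Ioi]
    refine lintegral_congr fun ρ => ?_
    by_cases h : 0 < ρ <;> simp [hG', indicator, h]
  rw [h1, ← lintegral_comp_polarCoord_symm, polarCoord_target]
  simp only [smul_eq_mul]
  rw [Measure.volume_eq_prod, ← Measure.prod_restrict, lintegral_prod _ hmp.aemeasurable]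
  refine setLIntegral_congr_fun measurableSet_Ioi fun s (hs : 0 < s) => ?_
  have hsub : Ioo 0 Real.pi ⊆ Ioo (-Real.pi) Real.pi :=
    Ioo_subset_Ioo_left (by linarith [Real.pi_pos])
  rw [← lintegral_indicator measurableSet_Ioo, ← lintegral_indicator measurableSet_Ioo]
  refine lintegral_congr fun φ => ?_
  by_cases hφ : φ ∈ Ioo (-Real.pi) Real.pi
  · rw [indicator_of_mem hφ]
    rcases le_or_gt φ 0 with h0 | h0
    · have h2 : φ ∉ Ioo 0 Real.pi := fun h => absurd h.1 (not_lt.2 h0)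
      have h3 : Real.sin φ ≤ 0 := Real.sin_nonpos_of_nonpos_of_neg_pi_le h0 hφ.1.le
      rw [indicator_of_notMem h2]
      have : ¬ 0 < s * Real.sin φ := not_lt.2 (mul_nonpos_of_nonneg_of_nonpos hs.le h3)
      simp [hG', polarCoord_symm_apply, this]
    · have h2 : φ ∈ Ioo 0 Real.pi := ⟨h0, hφ.2⟩
      have h3 : 0 < Real.sin φ := Real.sin_pos_of_pos_of_lt_pi h0 hφ.2
      rw [indicator_of_mem h2]
      have : 0 < s * Real.sin φ := mul_pos hs h3
      simp [hG', polarCoord_symm_apply, this]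
  · rw [indicator_of_notMem hφ, indicator_of_notMem fun h => hφ (hsub h)]

end Polar

/-! ### Laplace transform of a coordinate on the sphere. -/

section SphereLaplace

open Set Metric

/-- The Laplace transform of the first coordinate on the unit sphere of `ℝ^(m+1)`. -/
noncomputable def sphereLaplace (m : ℕ) (t : ℝ) : ℝ :=
  ∫ w : sphere (0 : EuclideanSpace ℝ (Fin (m + 1))) 1, Real.exp (t * w.1 0) ∂volume.toSphere

/-- Antipodal symmetry shows that a coordinate has mean zero on the sphere, the centring required by
`isTiltedLaplace_integral`. -/
theorem measurePreserving_neg_toSphere {E : Type*} [NormedAddCommGroup E] [NormedSpace ℝ E]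
    [MeasurableSpace E] [BorelSpace E] [FiniteDimensional ℝ E]
    (μ : Measure E) [μ.IsAddHaarMeasure] :
    MeasurePreserving (fun u : sphere (0 : E) 1 => -u) μ.toSphere μ.toSphere := by
  have hneg : Measurable fun u : sphere (0 : E) 1 => -u := continuous_neg.measurable
  refine ⟨hneg, ?_⟩
  ext s hs
  rw [Measure.map_apply hneg hs, Measure.toSphere_apply' _ hs, Measure.toSphere_apply' _ (hneg hs)]
  congr 1
  rw [← Measure.measure_neg μ]
  congr 1
  ext y
  simp only [Set.mem_neg, Set.mem_smul, mem_image, mem_preimage]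
  constructor
  · rintro ⟨r, hr, _, ⟨u, hu, rfl⟩, h⟩
    exact ⟨r, hr, _, ⟨-u, hu, rfl⟩, by rw [← neg_neg y, ← h]; simp⟩
  · rintro ⟨r, hr, _, ⟨u, hu, rfl⟩, rfl⟩
    exact ⟨r, hr, _, ⟨-u, by simpa using hu, rfl⟩, by simp⟩

theorem isTiltedLaplace_sphereLaplace (m : ℕ) : IsTiltedLaplace (sphereLaplace m) := by
  refine isTiltedLaplace_integral
    (volume : Measure (EuclideanSpace ℝ (Fin (m + 1)))).toSphere
    (Measure.toSphere_ne_zero _) (fun w => w.1 0) (by fun_prop) (fun w => ?_) ?_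
  · have h := PiLp.norm_apply_le w.1 0
    rwa [norm_eq_of_mem_sphere] at h
  · have hmp := measurePreserving_neg_toSphere
      (volume : Measure (EuclideanSpace ℝ (Fin (m + 1))))
    have hemb : MeasurableEmbedding
        fun u : sphere (0 : EuclideanSpace ℝ (Fin (m + 1))) 1 => -u :=
      (Homeomorph.neg _).measurableEmbedding
    have h := hmp.integral_comp hemb (fun w => w.1 0)
    simp only [coe_neg_sphere, PiLp.neg_apply, integral_neg] at h
    linarith

theorem ofReal_sphereLaplace (m : ℕ) (t : ℝ) : ENNReal.ofReal (sphereLaplace m t) =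
    ∫⁻ w : sphere (0 : EuclideanSpace ℝ (Fin (m + 1))) 1, ENNReal.ofReal (Real.exp (t * w.1 0))
      ∂volume.toSphere := by
  refine ofReal_integral_eq_lintegral_ofReal ?_ (ae_of_all _ fun _ => (Real.exp_pos _).le)
  have hc : Continuous fun w : sphere (0 : EuclideanSpace ℝ (Fin (m + 1))) 1 =>
    Real.exp (t * w.1 0) := by fun_prop
  exact hc.integrable_of_hasCompactSupport (HasCompactSupport.of_compactSpace _)

end SphereLaplace

/-! ### Polar coordinates around a given direction. -/

section Coordinates

open Set Metric

theorem exists_orthonormalBasis_pair {E : Type*} [NormedAddCommGroup E] [InnerProductSpace ℝ E]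
    [FiniteDimensional ℝ E] {m : ℕ} (hE : Module.finrank ℝ E = m + 2) {u v : E} (hu : ‖u‖ = 1)
    (hv : ‖v‖ = 1) (huv : inner ℝ u v = 0) :
    ∃ B : OrthonormalBasis (Fin (m + 2)) ℝ E, B 0 = u ∧ B 1 = v := by
  have h : Orthonormal ℝ (Set.domRestrict ({0, 1} : Set (Fin (m + 2)))
      (fun i => if i = 0 then u else v)) := by
    constructor
    · rintro ⟨i, hi⟩
      by_cases h : i = 0 <;> simp [h, hu, hv]
    · rintro ⟨i, hi⟩ ⟨j, hj⟩ hij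
      have hij' : i ≠ j := fun h => hij (Subtype.ext h)
      rcases hi with rfl | rfl <;> rcases hj with rfl | rfl
      · exact absurd rfl hij'
      · simpa using huv
      · simpa [real_inner_comm] using huv
      · exact absurd rfl hij'
  obtain ⟨B, hB⟩ := h.exists_orthonormalBasis_extension_of_card_eq (by simpa using hE)
  exact ⟨B, by simpa using hB 0 (by simp), by simpa using hB 1 (by simp)⟩

theorem exists_unit_orthogonal_decomposition {E : Type*} [NormedAddCommGroup E]
    [InnerProductSpace ℝ E] [FiniteDimensional ℝ E] {m : ℕ} (hE : Module.finrank ℝ E = m + 2)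
    {u : E} (hu : ‖u‖ = 1) (b : E) : ∃ v : E, ‖v‖ = 1 ∧ inner ℝ u v = 0 ∧
      b = (inner ℝ u b : ℝ) • u + √(‖b‖ ^ 2 - (inner ℝ u b) ^ 2) • v := by
  set n := b - (inner ℝ u b : ℝ) • u with hn
  have huu : inner ℝ u u = 1 := by rw [real_inner_self_eq_norm_sq, hu, one_pow]
  have hun : inner ℝ u n = 0 := by
    rw [hn, inner_sub_right, inner_smul_right, huu]; simp
  have hnorm : ‖n‖ = √(‖b‖ ^ 2 - (inner ℝ u b) ^ 2) := by
    rw [← Real.sqrt_sq (norm_nonneg n), hn, norm_sub_sq_real, norm_smul, hu, inner_smul_right,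
      real_inner_comm]
    congr 1
    rw [Real.norm_eq_abs, mul_one, sq_abs]; ring
  rcases eq_or_ne n 0 with h0 | h0
  -- When `b` is parallel to `u` its orthogonal part gives no direction; any unit vector orthogonal
  -- to `u` serves, and one exists since the dimension is at least `2`.
  · have : Fact (Module.finrank ℝ E = (m + 1) + 1) := ⟨hE⟩
    have hu0 : u ≠ 0 := by rintro rfl; simp at hu
    have hfin := Submodule.finrank_orthogonal_span_singleton (𝕜 := ℝ) (n := m + 1) hu0
    have : Nontrivial (Submodule.span ℝ {u})ᗮ :=
      Module.nontrivial_of_finrank_pos (R := ℝ) (by omega)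
    obtain ⟨w, hw⟩ := exists_ne (0 : (Submodule.span ℝ {u})ᗮ)
    have hw' : (w : E) ≠ 0 := by simpa using hw
    have huw : inner ℝ u (w : E) = 0 := Submodule.mem_orthogonal_singleton_iff_inner_right.1 w.2
    refine ⟨‖(w : E)‖⁻¹ • (w : E), ?_, ?_, ?_⟩
    · rw [norm_smul, norm_inv, norm_norm, inv_mul_cancel₀ (norm_ne_zero_iff.2 hw')]
    · rw [inner_smul_right, huw, mul_zero]
    · rw [← hnorm, h0, norm_zero, zero_smul, add_zero]
      exact sub_eq_zero.1 h0
  · have hn0 : ‖n‖ ≠ 0 := norm_ne_zero_iff.2 h0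
    refine ⟨‖n‖⁻¹ • n, ?_, ?_, ?_⟩
    · rw [norm_smul, norm_inv, norm_norm, inv_mul_cancel₀ hn0]
    · rw [inner_smul_right, hun, mul_zero]
    · rw [← hnorm, smul_smul, mul_inv_cancel₀ hn0, one_smul, hn]; abel

/-- In these coordinates the angle with `u` depends only on the axial component and the orthogonal
norm, and the inner product with `b` involves just one orthogonal coordinate. -/
theorem exists_linearIsometryEquiv_prod {m : ℕ} {u : EuclideanSpace ℝ (Fin (m + 2))}
    (hu : ‖u‖ = 1) (b : EuclideanSpace ℝ (Fin (m + 2))) :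
    ∃ T : EuclideanSpace ℝ (Fin (m + 2)) ≃ₗᵢ[ℝ] WithLp 2 (ℝ × EuclideanSpace ℝ (Fin (m + 1))),
      T u = WithLp.toLp 2 (1, 0) ∧ T b = WithLp.toLp 2
        (inner ℝ u b, √(‖b‖ ^ 2 - (inner ℝ u b) ^ 2) • EuclideanSpace.single 0 1) := by
  obtain ⟨v, hv, huv, hb⟩ := exists_unit_orthogonal_decomposition (m := m) (by simp) hu b
  obtain ⟨B, hB0, hB1⟩ := exists_orthonormalBasis_pair (m := m) (by simp) hu hv huv
  have hfin : Module.finrank ℝ (WithLp 2 (ℝ × EuclideanSpace ℝ (Fin (m + 1)))) = m + 2 := by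
    rw [(WithLp.linearEquiv 2 ℝ _).finrank_eq]
    simp; ring
  obtain ⟨B', hB0', hB1'⟩ := exists_orthonormalBasis_pair hfin
    (u := WithLp.toLp 2 (1, 0)) (v := WithLp.toLp 2 (0, EuclideanSpace.single 0 1))
    (by simp) (by simp) (by simp)
  refine ⟨B.equiv B' (Equiv.refl _), ?_, ?_⟩
  · rw [← hB0, ← hB0', OrthonormalBasis.equiv_apply_basis]; rfl
  · set α := inner ℝ u b
    set β := √(‖b‖ ^ 2 - α ^ 2)
    rw [hb, map_add, map_smul, map_smul, ← hB0, ← hB1, OrthonormalBasis.equiv_apply_basis,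
      OrthonormalBasis.equiv_apply_basis, Equiv.refl_apply, Equiv.refl_apply, hB0', hB1']
    apply (WithLp.linearEquiv 2 ℝ _).injective
    simp

/-- Integration in polar coordinates around a direction `u`, against an exponential weight. -/
theorem lintegral_norm_angle_exp {m : ℕ} {u : EuclideanSpace ℝ (Fin (m + 2))}
    (hu : ‖u‖ = 1) (b : EuclideanSpace ℝ (Fin (m + 2))) {F : ℝ × ℝ → ENNReal} (hF : Measurable F) :
    ∫⁻ z, F (‖z‖, InnerProductGeometry.angle u z) * ENNReal.ofReal (Real.exp (inner ℝ z b)) =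
      ∫⁻ s in Ioi (0 : ℝ), ∫⁻ φ in Ioo 0 Real.pi, F (s, φ) * (ENNReal.ofReal (s ^ (m + 1)) *
        ENNReal.ofReal (angularKernel (sphereLaplace m) m (s * inner ℝ u b)
          (s * √(‖b‖ ^ 2 - (inner ℝ u b) ^ 2)) φ)) := by
  obtain ⟨T, hTu, hTb⟩ := exists_linearIsometryEquiv_prod hu b
  set α := inner ℝ u b
  set β := √(‖b‖ ^ 2 - α ^ 2)
  set e : EuclideanSpace ℝ (Fin (m + 1)) := EuclideanSpace.single 0 1
  set K : ℝ × EuclideanSpace ℝ (Fin (m + 1)) → ENNReal := fun p =>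
    F (√(p.1 ^ 2 + ‖p.2‖ ^ 2), Real.arccos (p.1 / √(p.1 ^ 2 + ‖p.2‖ ^ 2))) *
      ENNReal.ofReal (Real.exp (α * p.1 + β * p.2 0)) with hK
  have hKm : Measurable K := by
    refine Measurable.mul (hF.comp ?_) (by fun_prop)
    exact Measurable.prodMk (by fun_prop) (Real.measurable_arccos.comp (by fun_prop))
  have h1 : ∀ z, F (‖z‖, InnerProductGeometry.angle u z) *
      ENNReal.ofReal (Real.exp (inner ℝ z b)) = K (WithLp.ofLp (T z)) := by
    intro z
    have hn : ‖z‖ = √((T z).fst ^ 2 + ‖(T z).snd‖ ^ 2) := by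
      rw [← T.norm_map z, WithLp.prod_norm_eq_of_L2]; simp
    have hi : inner ℝ u z = (T z).fst := by
      rw [← T.inner_map_map, hTu]; simp
    have hb : inner ℝ z b = α * (T z).fst + β * (T z).snd 0 := by
      rw [← T.inner_map_map, hTb]
      simp [e, inner_smul_right, EuclideanSpace.inner_single_right]
    rw [hK]
    simp only [InnerProductGeometry.angle, hu, one_mul]
    rw [hi, hb, hn]
    rfl
  -- Polar coordinates in the orthogonal space: the direction enters only through its first
  -- coordinate, so integrating it out gives `sphereLaplace m (β ρ)`.
  have h2 : ∀ x : ℝ, ∫⁻ y, K (x, y) = ∫⁻ ρ in Ioi (0 : ℝ),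
      ENNReal.ofReal (ρ ^ m) * (F (√(x ^ 2 + ρ ^ 2), Real.arccos (x / √(x ^ 2 + ρ ^ 2))) *
        (ENNReal.ofReal (Real.exp (α * x)) * ENNReal.ofReal (sphereLaplace m (β * ρ)))) := by
    intro x
    rw [lintegral_eq_lintegral_toSphere volume
      (G := fun y => K (x, y)) (hKm.comp measurable_prodMk_left)]
    refine setLIntegral_congr_fun measurableSet_Ioi fun ρ (hρ : 0 < ρ) => ?_
    simp only [finrank_euclideanSpace_fin, Nat.add_sub_cancel]
    congr 1
    rw [ofReal_sphereLaplace, ← lintegral_const_mul _ (by fun_prop),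
      ← lintegral_const_mul _ (by fun_prop)]
    refine lintegral_congr fun w => ?_
    have hw : ‖ρ • (w : EuclideanSpace ℝ (Fin (m + 1)))‖ = ρ := by
      rw [norm_smul, norm_eq_of_mem_sphere, mul_one, Real.norm_of_nonneg hρ.le]
    simp only [hK, hw]
    rw [← ENNReal.ofReal_mul (Real.exp_pos _).le, ← Real.exp_add]
    simp [mul_assoc]
  have hJ := isTiltedLaplace_sphereLaplace m
  have hJc := hJ.continuous
  set Q : ℝ × ℝ → ENNReal := fun p => ENNReal.ofReal (p.2 ^ m) *
      (F (√(p.1 ^ 2 + p.2 ^ 2), Real.arccos (p.1 / √(p.1 ^ 2 + p.2 ^ 2))) *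
        (ENNReal.ofReal (Real.exp (α * p.1)) * ENNReal.ofReal (sphereLaplace m (β * p.2))))
  have hQm : Measurable Q := by
    refine Measurable.mul (by fun_prop) (Measurable.mul (hF.comp ?_) (by fun_prop))
    exact Measurable.prodMk (by fun_prop) (Real.measurable_arccos.comp (by fun_prop))
  calc _ = ∫⁻ z, K (WithLp.ofLp (T z)) := lintegral_congr h1
    _ = ∫⁻ q : WithLp 2 (ℝ × EuclideanSpace ℝ (Fin (m + 1))), K (WithLp.ofLp q) :=
      T.measurePreserving.lintegral_comp (hKm.comp (WithLp.volume_preserving_ofLp _ _).measurable)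
    _ = ∫⁻ p, K p := (WithLp.volume_preserving_ofLp _ _).lintegral_comp hKm
    _ = ∫⁻ x : ℝ, ∫⁻ ρ in Ioi (0 : ℝ), Q (x, ρ) := by
      rw [Measure.volume_eq_prod, lintegral_prod _ hKm.aemeasurable]
      exact lintegral_congr h2
    _ = ∫⁻ s in Ioi (0 : ℝ), ∫⁻ φ in Ioo 0 Real.pi,
        ENNReal.ofReal s * Q (s * Real.cos φ, s * Real.sin φ) :=
      lintegral_upper_half_plane_polar hQm
    _ = _ := by
      refine setLIntegral_congr_fun measurableSet_Ioi fun s (hs : 0 < s) => ?_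
      refine setLIntegral_congr_fun measurableSet_Ioo fun φ hφ => ?_
      have hsq : √((s * Real.cos φ) ^ 2 + (s * Real.sin φ) ^ 2) = s := by
        rw [← Real.sqrt_sq hs.le]
        congr 1
        rw [Real.sqrt_sq hs.le]
        linear_combination s ^ 2 * Real.sin_sq_add_cos_sq φ
      have hsin : 0 < Real.sin φ := Real.sin_pos_of_mem_Ioo hφ
      simp only [Q, hsq]
      rw [mul_div_cancel_left₀ _ hs.ne', Real.arccos_cos hφ.1.le hφ.2.le, angularKernel,
        mul_left_comm, mul_left_comm (ENNReal.ofReal s), ← ENNReal.ofReal_mul (by positivity),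
        ← ENNReal.ofReal_mul (by positivity), ← ENNReal.ofReal_mul (by positivity)]
      rw [mul_left_comm, ← ENNReal.ofReal_mul (by positivity)]
      congr 2
      ring_nf

end Coordinates

/-! ### The explicit density as an average over directions, and its bounds. -/

section Numerator

open Set Metric

variable {m : ℕ}

/-- The angular kernel of the second point around a direction `u` of the first one, at radius
`s`. -/
noncomputable def directionKernel (m : ℕ) (b : EuclideanSpace ℝ (Fin (m + 2)))
    (u : EuclideanSpace ℝ (Fin (m + 2))) (s φ : ℝ) : ℝ :=
  angularKernel (sphereLaplace m) m (s * inner ℝ u b) (s * √(‖b‖ ^ 2 - (inner ℝ u b) ^ 2)) φ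

/-- The unnormalised density of the angle at given radii. -/
noncomputable def angleNumerator (m : ℕ) (a b : EuclideanSpace ℝ (Fin (m + 2))) (φ : ℝ)
    (w : ℝ × ℝ) : ℝ :=
  ∫ u : sphere (0 : EuclideanSpace ℝ (Fin (m + 2))) 1,
    Real.exp (w.1 * inner ℝ u.1 a) * directionKernel m b u w.2 φ ∂volume.toSphere

/-- The total mass of `angleNumerator`. -/
noncomputable def angleNormalizer (m : ℕ) (a b : EuclideanSpace ℝ (Fin (m + 2)))
    (w : ℝ × ℝ) : ℝ :=
  ∫ u : sphere (0 : EuclideanSpace ℝ (Fin (m + 2))) 1,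
    Real.exp (w.1 * inner ℝ u.1 a) * (∫ φ in (0)..Real.pi, directionKernel m b u w.2 φ)
      ∂volume.toSphere

@[fun_prop]
theorem continuous_directionKernel {X : Type*} [TopologicalSpace X]
    (b : EuclideanSpace ℝ (Fin (m + 2))) {u : X → EuclideanSpace ℝ (Fin (m + 2))} {s φ : X → ℝ}
    (hu : Continuous u) (hs : Continuous s) (hφ : Continuous φ) :
    Continuous fun x => directionKernel m b (u x) (s x) (φ x) := by
  have := (isTiltedLaplace_sphereLaplace m).continuous
  unfold directionKernel angularKernel
  fun_prop

theorem directionKernel_nonneg (b u : EuclideanSpace ℝ (Fin (m + 2))) (s : ℝ) {φ : ℝ}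
    (hφ : φ ∈ Icc 0 Real.pi) : 0 ≤ directionKernel m b u s φ :=
  angularKernel_nonneg (isTiltedLaplace_sphereLaplace m) hφ

@[fun_prop]
theorem continuous_integral_directionKernel {X : Type*} [TopologicalSpace X]
    (b : EuclideanSpace ℝ (Fin (m + 2))) {u : X → EuclideanSpace ℝ (Fin (m + 2))} {s : X → ℝ}
    (hu : Continuous u) (hs : Continuous s) :
    Continuous fun x => ∫ φ in (0)..Real.pi, directionKernel m b (u x) (s x) φ := by
  have h : Continuous (Function.uncurry fun (x : X) (φ : ℝ) =>
      directionKernel m b (u x) (s x) φ) := by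
    unfold Function.uncurry; fun_prop
  exact intervalIntegral.continuous_parametric_intervalIntegral_of_continuous' h 0 Real.pi

theorem integrable_sphere_of_continuous
    {h : sphere (0 : EuclideanSpace ℝ (Fin (m + 2))) 1 → ℝ} (hh : Continuous h) :
    Integrable h (volume : Measure (EuclideanSpace ℝ (Fin (m + 2)))).toSphere :=
  hh.integrable_of_hasCompactSupport (HasCompactSupport.of_compactSpace _)

theorem continuous_angleNumerator (a b : EuclideanSpace ℝ (Fin (m + 2))) :
    Continuous (Function.uncurry (angleNumerator m a b)) := by
  have hc : Continuous (Function.uncurry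
      fun (p : ℝ × ℝ × ℝ) (u : sphere (0 : EuclideanSpace ℝ (Fin (m + 2))) 1) =>
      Real.exp (p.2.1 * inner ℝ u.1 a) * directionKernel m b u p.2.2 p.1) := by
    unfold Function.uncurry; fun_prop
  have h := continuous_parametric_integral_of_continuous
    (μ := (volume : Measure (EuclideanSpace ℝ (Fin (m + 2)))).toSphere) hc isCompact_univ
  simp only [Measure.restrict_univ] at h
  exact h

theorem continuous_angleNormalizer (a b : EuclideanSpace ℝ (Fin (m + 2))) :
    Continuous (angleNormalizer m a b) := by
  have hc : Continuous (Function.uncurry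
      fun (p : ℝ × ℝ) (u : sphere (0 : EuclideanSpace ℝ (Fin (m + 2))) 1) =>
      Real.exp (p.1 * inner ℝ u.1 a) * ∫ φ in (0)..Real.pi, directionKernel m b u p.2 φ) := by
    unfold Function.uncurry; fun_prop
  have h := continuous_parametric_integral_of_continuous
    (μ := (volume : Measure (EuclideanSpace ℝ (Fin (m + 2)))).toSphere) hc isCompact_univ
  simp only [Measure.restrict_univ] at h
  exact h

theorem angleNumerator_nonneg (a b : EuclideanSpace ℝ (Fin (m + 2))) {φ : ℝ}
    (hφ : φ ∈ Icc 0 Real.pi) (w : ℝ × ℝ) : 0 ≤ angleNumerator m a b φ w :=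
  integral_nonneg fun _ => mul_nonneg (Real.exp_pos _).le (directionKernel_nonneg b _ _ hφ)

theorem integral_directionKernel_pos (b u : EuclideanSpace ℝ (Fin (m + 2))) (s : ℝ) :
    0 < ∫ φ in (0)..Real.pi, directionKernel m b u s φ := by
  have hJ := isTiltedLaplace_sphereLaplace m
  refine intervalIntegral.intervalIntegral_pos_of_pos_on
    ((continuous_angularKernel hJ).intervalIntegrable _ _) (fun φ hφ => ?_) Real.pi_pos
  have := Real.sin_pos_of_mem_Ioo hφ
  have := hJ.pos (s * √(‖b‖ ^ 2 - (inner ℝ u b) ^ 2) * Real.sin φ)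
  unfold directionKernel angularKernel
  positivity

theorem angleNormalizer_pos (a b : EuclideanSpace ℝ (Fin (m + 2))) (w : ℝ × ℝ) :
    0 < angleNormalizer m a b w := by
  have hc : Continuous fun u : sphere (0 : EuclideanSpace ℝ (Fin (m + 2))) 1 =>
      Real.exp (w.1 * inner ℝ u.1 a) * ∫ φ in (0)..Real.pi, directionKernel m b u w.2 φ := by
    fun_prop
  have hpos : ∀ u : sphere (0 : EuclideanSpace ℝ (Fin (m + 2))) 1,
      0 < Real.exp (w.1 * inner ℝ u.1 a) *
        ∫ φ in (0)..Real.pi, directionKernel m b u w.2 φ :=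
    fun u => mul_pos (Real.exp_pos _) (integral_directionKernel_pos b _ _)
  refine (integral_pos_iff_support_of_nonneg (fun u => (hpos u).le)
    (integrable_sphere_of_continuous hc)).2 ?_
  rw [Function.support_eq_univ (fun u => (hpos u).ne')]
  exact Measure.measure_univ_pos.2 (Measure.toSphere_ne_zero _)

theorem ofReal_angleNumerator (a b : EuclideanSpace ℝ (Fin (m + 2))) {φ : ℝ}
    (hφ : φ ∈ Icc 0 Real.pi) (w : ℝ × ℝ) : ENNReal.ofReal (angleNumerator m a b φ w) =
    ∫⁻ u : sphere (0 : EuclideanSpace ℝ (Fin (m + 2))) 1,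
      ENNReal.ofReal (Real.exp (w.1 * inner ℝ u.1 a)) *
        ENNReal.ofReal (directionKernel m b u w.2 φ) ∂volume.toSphere := by
  have hc : Continuous fun u : sphere (0 : EuclideanSpace ℝ (Fin (m + 2))) 1 =>
      Real.exp (w.1 * inner ℝ u.1 a) * directionKernel m b u w.2 φ := by
    fun_prop
  rw [angleNumerator, ofReal_integral_eq_lintegral_ofReal (integrable_sphere_of_continuous hc)
    (ae_of_all _ fun u => mul_nonneg (Real.exp_pos _).le (directionKernel_nonneg b _ _ hφ))]
  exact lintegral_congr fun u => ENNReal.ofReal_mul (Real.exp_pos _).le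

theorem lintegral_angleNumerator (a b : EuclideanSpace ℝ (Fin (m + 2))) (w : ℝ × ℝ) :
    ∫⁻ φ in Ioo 0 Real.pi, ENNReal.ofReal (angleNumerator m a b φ w) =
      ENNReal.ofReal (angleNormalizer m a b w) := by
  have hc : Continuous fun u : sphere (0 : EuclideanSpace ℝ (Fin (m + 2))) 1 =>
      Real.exp (w.1 * inner ℝ u.1 a) * ∫ φ in (0)..Real.pi, directionKernel m b u w.2 φ := by
    fun_prop
  rw [angleNormalizer, ofReal_integral_eq_lintegral_ofReal (integrable_sphere_of_continuous hc)
    (ae_of_all _ fun u => mul_nonneg (Real.exp_pos _).le (integral_directionKernel_pos b _ _).le)]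
  have hm : Measurable fun p : ℝ × sphere (0 : EuclideanSpace ℝ (Fin (m + 2))) 1 =>
      ENNReal.ofReal (Real.exp (w.1 * inner ℝ p.2.1 a)) *
        ENNReal.ofReal (directionKernel m b p.2 w.2 p.1) := by
    have : Continuous fun p : ℝ × sphere (0 : EuclideanSpace ℝ (Fin (m + 2))) 1 =>
        directionKernel m b p.2 w.2 p.1 := by fun_prop
    exact Measurable.mul (by fun_prop) this.measurable.ennreal_ofReal
  rw [setLIntegral_congr_fun measurableSet_Ioo fun φ hφ =>
    ofReal_angleNumerator a b (Ioo_subset_Icc_self hφ) w, lintegral_lintegral_swap hm.aemeasurable]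
  refine lintegral_congr fun u => ?_
  have hk : Continuous fun φ => directionKernel m b u w.2 φ := by fun_prop
  rw [lintegral_const_mul _ hk.measurable.ennreal_ofReal, ENNReal.ofReal_mul (Real.exp_pos _).le,
    intervalIntegral.integral_of_le Real.pi_pos.le, ofReal_integral_eq_lintegral_ofReal
      (hk.integrableOn_Ioc) ((ae_restrict_mem measurableSet_Ioc).mono fun φ hφ =>
        directionKernel_nonneg b _ _ ⟨hφ.1.le, hφ.2⟩), restrict_Ioo_eq_restrict_Ioc]

/-- These are the hypotheses of the kernel bounds with `κ = s‖b‖`, which does not depend on `u`. -/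
theorem abs_mul_inner_le {b u : EuclideanSpace ℝ (Fin (m + 2))} (hu : ‖u‖ = 1) {s : ℝ}
    (hs : 0 ≤ s) : |s * inner ℝ u b| ≤ s * ‖b‖ ∧ 0 ≤ s * √(‖b‖ ^ 2 - (inner ℝ u b) ^ 2) ∧
      s * √(‖b‖ ^ 2 - (inner ℝ u b) ^ 2) ≤ s * ‖b‖ := by
  refine ⟨?_, by positivity, ?_⟩
  · rw [abs_mul, abs_of_nonneg hs]
    gcongr
    simpa [hu] using abs_real_inner_le_norm u b
  · gcongr
    rw [Real.sqrt_le_left (norm_nonneg b)]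
    linarith [sq_nonneg (inner ℝ u b)]

/-- Averaging over `u` with positive weights preserves a bound that is uniform in `u`; the position
of the first mean, encoded in `a`, thus drops out. -/
theorem angleNumerator_le_mul_normalizer (a b : EuclideanSpace ℝ (Fin (m + 2))) {B φ : ℝ}
    {w : ℝ × ℝ} (h : ∀ u : EuclideanSpace ℝ (Fin (m + 2)), ‖u‖ = 1 →
      directionKernel m b u w.2 φ ≤ B * ∫ φ in (0)..Real.pi, directionKernel m b u w.2 φ) :
    angleNumerator m a b φ w ≤ B * angleNormalizer m a b w := by
  have hc : Continuous fun u : sphere (0 : EuclideanSpace ℝ (Fin (m + 2))) 1 =>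
      Real.exp (w.1 * inner ℝ u.1 a) * ∫ φ in (0)..Real.pi, directionKernel m b u w.2 φ := by
    fun_prop
  have hc' : Continuous fun u : sphere (0 : EuclideanSpace ℝ (Fin (m + 2))) 1 =>
      Real.exp (w.1 * inner ℝ u.1 a) * directionKernel m b u w.2 φ := by
    fun_prop
  rw [angleNormalizer, ← integral_const_mul]
  refine integral_mono (integrable_sphere_of_continuous hc')
    ((integrable_sphere_of_continuous hc).const_mul B) fun u => ?_
  have h1 := mul_le_mul_of_nonneg_left (h u (norm_eq_of_mem_sphere u))
    (Real.exp_pos (w.1 * inner ℝ u.1 a)).le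
  calc _ ≤ _ := h1
    _ = _ := by ring

/-- The continuous density of the angle at given radii. -/
noncomputable def angleDensity (m : ℕ) (a b : EuclideanSpace ℝ (Fin (m + 2))) (φ : ℝ)
    (w : ℝ × ℝ) : ℝ :=
  angleNumerator m a b φ w / angleNormalizer m a b w

theorem continuous_angleDensity (a b : EuclideanSpace ℝ (Fin (m + 2))) :
    Continuous (Function.uncurry (angleDensity m a b)) :=
  (continuous_angleNumerator a b).div ((continuous_angleNormalizer a b).comp continuous_snd)
    fun _ => (angleNormalizer_pos a b _).ne'

theorem angleDensity_nonneg (a b : EuclideanSpace ℝ (Fin (m + 2))) {φ : ℝ}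
    (hφ : φ ∈ Icc 0 Real.pi) (w : ℝ × ℝ) : 0 ≤ angleDensity m a b φ w :=
  div_nonneg (angleNumerator_nonneg a b hφ w) (angleNormalizer_pos a b w).le

theorem angleDensity_le (a b : EuclideanSpace ℝ (Fin (m + 2))) {φ : ℝ}
    (hφ : φ ∈ Icc 0 Real.pi) {r s : ℝ} (hs : 0 ≤ s) :
    angleDensity m a b φ (r, s) ≤ Real.exp 4 * √(s * ‖b‖ + m + 2) := by
  rw [angleDensity, div_le_iff₀ (angleNormalizer_pos a b _)]
  refine angleNumerator_le_mul_normalizer a b fun u hu => ?_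
  obtain ⟨h1, h2, h3⟩ := abs_mul_inner_le (b := b) hu hs
  exact angularKernel_le_sqrt_mul_integral (isTiltedLaplace_sphereLaplace m) h1 h2 h3 hφ

theorem angularKernel_succ {J : ℝ → ℝ} (a τ φ : ℝ) :
    angularKernel J (m + 1) a τ φ = angularKernel J m a τ φ * Real.sin φ := by
  simp only [angularKernel]; ring

theorem angleDensity_div_sin_le (a b : EuclideanSpace ℝ (Fin (m + 1 + 2))) {φ : ℝ}
    (hφ : φ ∈ Ioo 0 Real.pi) {r s : ℝ} (hs : 0 ≤ s) :
    angleDensity (m + 1) a b φ (r, s) / Real.sin φ ≤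
      32 * Real.exp 4 * ((s * ‖b‖ + m + 3) / √(m + 3)) := by
  have hsin := Real.sin_pos_of_mem_Ioo hφ
  rw [div_le_iff₀ hsin, angleDensity, div_le_iff₀ (angleNormalizer_pos a b _)]
  refine angleNumerator_le_mul_normalizer a b fun u hu => ?_
  obtain ⟨h1, h2, h3⟩ := abs_mul_inner_le (b := b) hu hs
  -- The sine exponent is `m` while the Laplace transform has index `m + 1`; the kernel bounds hold
  -- for arbitrary `J`, so the two need not match.
  have h := angularKernel_le_mul_integral_mul_sin (m := m) (isTiltedLaplace_sphereLaplace (m + 1))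
    h1 h2 h3 (Ioo_subset_Icc_self hφ)
  simp only [directionKernel, angularKernel_succ]
  calc _ ≤ _ := mul_le_mul_of_nonneg_right h hsin.le
    _ = _ := by ring

end Numerator

/-! ### Uniqueness of the continuous version, and exchange of the two points. -/

section Uniqueness

open Set Topology Filter

/-- If `g < c₁ < c₂ < f` at a point, continuity keeps `g < c₁` and `c₂ < f` on a relatively open
rectangle of positive finite mass, on which both integrals should agree. -/
theorem IsContinuousCondDensity.le_of_open_pos {Ω : Type*} [MeasurableSpace Ω] {P : Measure Ω}
    [IsProbabilityMeasure P] {Φ : Ω → ℝ} {W : Ω → ℝ × ℝ} {α β : ℝ} (hαβ : α < β)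
    {D : Set (ℝ × ℝ)} (hD : IsOpen D)
    (hpos : ∀ U, IsOpen U → U.Nonempty → U ⊆ D → P.map W U ≠ 0)
    {f g : ℝ → ℝ × ℝ → ℝ} (hf : IsContinuousCondDensity P Φ W (Icc α β) D f)
    (hg : IsContinuousCondDensity P Φ W (Icc α β) D g) {φ₀ : ℝ} (hφ₀ : φ₀ ∈ Icc α β)
    {w₀ : ℝ × ℝ} (hw₀ : w₀ ∈ D) : f φ₀ w₀ ≤ g φ₀ w₀ := by
  by_contra! hlt
  obtain ⟨c₁, hc₁, hc₁'⟩ := exists_between hlt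
  obtain ⟨c₂, hc₂, hc₂'⟩ := exists_between hc₁'
  have hc₂0 : 0 < c₂ := ((hg.nonneg φ₀ hφ₀ w₀ hw₀).trans_lt hc₁).trans hc₂
  have hmem : (φ₀, w₀) ∈ Icc α β ×ˢ D := ⟨hφ₀, hw₀⟩
  have e1 := (hf.continuousOn _ hmem).eventually (lt_mem_nhds hc₂')
  have e2 := (hg.continuousOn _ hmem).eventually (gt_mem_nhds hc₁)
  have e3 := e1.and e2
  rw [nhdsWithin_prod_eq] at e3
  obtain ⟨pa, hpa, pb, hpb, hp⟩ := eventually_prod_iff.1 e3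
  obtain ⟨U, hU, hU₀, hUs⟩ := mem_nhdsWithin.1 hpa
  obtain ⟨V, hV, hV₀, hVs⟩ := mem_nhdsWithin.1 hpb
  have hA : IsOpen (V ∩ D) := hV.inter hD
  have hA0 : P.map W (V ∩ D) ≠ 0 := hpos _ hA ⟨w₀, hV₀, hw₀⟩ inter_subset_right
  have hAtop : P.map W (V ∩ D) ≠ ⊤ := measure_ne_top _ _
  -- The point `φ₀` may be an endpoint; it still lies in the closure of the open interval.
  have hB0 : volume (U ∩ Icc α β) ≠ 0 := by
    have hne : (U ∩ Ioo α β).Nonempty := by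
      have : φ₀ ∈ closure (Ioo α β) := by rwa [closure_Ioo hαβ.ne]
      exact mem_closure_iff.1 this U hU hU₀
    refine fun h => (hU.inter isOpen_Ioo).measure_ne_zero volume hne ?_
    exact measure_mono_null (inter_subset_inter_right _ Ioo_subset_Icc_self) h
  have hBtop : volume (U ∩ Icc α β) ≠ ⊤ :=
    ((measure_mono inter_subset_right).trans_lt isCompact_Icc.measure_lt_top).ne
  have hBm : MeasurableSet (U ∩ Icc α β) := hU.measurableSet.inter measurableSet_Icc
  have heq := (hf.measure_eq _ _ hA.measurableSet hU.measurableSet).symm.trans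
    (hg.measure_eq _ _ hA.measurableSet hU.measurableSet)
  have hlow : ENNReal.ofReal c₂ * volume (U ∩ Icc α β) * P.map W (V ∩ D) ≤
      ∫⁻ w in V ∩ D, (∫⁻ φ in U ∩ Icc α β, ENNReal.ofReal (f φ w)) ∂(P.map W) := by
    rw [← setLIntegral_const]
    refine setLIntegral_mono' hA.measurableSet fun w hw => ?_
    rw [← setLIntegral_const]
    refine setLIntegral_mono' hBm fun φ hφ => ?_
    exact ENNReal.ofReal_le_ofReal (hp (hUs hφ) (hVs hw)).1.le
  have hup : ∫⁻ w in V ∩ D, (∫⁻ φ in U ∩ Icc α β, ENNReal.ofReal (g φ w)) ∂(P.map W) ≤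
      ENNReal.ofReal c₁ * volume (U ∩ Icc α β) * P.map W (V ∩ D) := by
    rw [← setLIntegral_const]
    refine setLIntegral_mono' hA.measurableSet fun w hw => ?_
    rw [← setLIntegral_const]
    refine setLIntegral_mono' hBm fun φ hφ => ?_
    exact ENNReal.ofReal_le_ofReal (hp (hUs hφ) (hVs hw)).2.le
  have h1 := hlow.trans (heq.le.trans hup)
  rw [ENNReal.mul_le_mul_iff_left hA0 hAtop, ENNReal.mul_le_mul_iff_left hB0 hBtop,
    ENNReal.ofReal_le_ofReal_iff'] at h1
  rcases h1 with h1 | h1 <;> linarith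

/-- Exchanging the two points exchanges the two conditioning radii. -/
theorem IsCondAngleDensity.swap {Ω : Type*} [MeasurableSpace Ω] {P : Measure Ω} {d : ℕ}
    {x : EuclideanSpace ℝ (Fin d)} {Y Z : Ω → EuclideanSpace ℝ (Fin d)} (hY : Measurable Y)
    (hZ : Measurable Z) {f : ℝ → ℝ × ℝ → ℝ} (hf : IsCondAngleDensity P x Y Z f) :
    IsCondAngleDensity P x Z Y (fun φ w => f φ w.swap) := by
  refine ⟨fun φ hφ w hw => hf.nonneg φ hφ _ ⟨hw.2, hw.1⟩, ?_, fun A B hA hB => ?_⟩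
  · refine hf.continuousOn.comp (f := fun p : ℝ × ℝ × ℝ => (p.1, p.2.swap)) (by fun_prop) ?_
    exact fun p hp => ⟨hp.1, hp.2.2, hp.2.1⟩
  · have hmap : P.map (fun ω => (‖x - Z ω‖, ‖x - Y ω‖)) =
        (P.map (fun ω => (‖x - Y ω‖, ‖x - Z ω‖))).map Prod.swap := by
      rw [Measure.map_map measurable_swap (by fun_prop)]; rfl
    have h := hf.measure_eq (Prod.swap ⁻¹' A) B (measurable_swap hA) hB
    rw [hmap, Measure.restrict_map measurable_swap hA,
      show (Prod.swap : ℝ × ℝ → ℝ × ℝ) = MeasurableEquiv.prodComm from rfl, lintegral_map_equiv]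
    · simp only [InnerProductGeometry.angle_comm (Z _ - x)]
      exact h

end Uniqueness

/-! ### Joint law of the two radii and the angle. -/

section JointLaw

open Set Metric

theorem lintegral_sub_isotropicGaussian {d : ℕ} (x μ : EuclideanSpace ℝ (Fin d)) {σ : ℝ}
    (hσ : 0 < σ) : ∃ c : ℝ, 0 < c ∧ ∀ G : EuclideanSpace ℝ (Fin d) → ENNReal, Measurable G →
      ∫⁻ y, G (y - x) ∂(isotropicGaussian μ σ) = ENNReal.ofReal c *
        ∫⁻ y, G y * ENNReal.ofReal (Real.exp (-(2 * σ ^ 2)⁻¹ * ‖y‖ ^ 2)) *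
          ENNReal.ofReal (Real.exp (inner ℝ y ((σ ^ 2)⁻¹ • (μ - x)))) := by
  obtain ⟨c, hc, h⟩ := exists_isotropicGaussian_eq_withDensity μ hσ
  -- Expanding `‖y - (μ - x)‖²` leaves a radial factor, an exponential of a linear form, and this
  -- constant.
  refine ⟨c * Real.exp (-(2 * σ ^ 2)⁻¹ * ‖μ - x‖ ^ 2), by positivity, fun G hG => ?_⟩
  rw [h, lintegral_withDensity_eq_lintegral_mul _ (by fun_prop)
      (g := fun y => G (y - x)) (hG.comp (by fun_prop)),
    ← lintegral_add_right_eq_self _ x, ← lintegral_const_mul _ (by fun_prop)]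
  refine lintegral_congr fun y => ?_
  simp only [Pi.mul_apply, add_sub_cancel_right]
  rw [mul_assoc (G y), mul_left_comm _ (G y), mul_comm _ (G y),
    ← ENNReal.ofReal_mul (Real.exp_pos _).le, ← ENNReal.ofReal_mul (by positivity),
    ← Real.exp_add, mul_assoc c, ← Real.exp_add]
  congr 4
  have e : y + x - μ = y - (μ - x) := by abel
  rw [e, norm_sub_sq_real, inner_smul_right]
  field_simp
  ring

/-- The radial weight of a Gaussian vector in dimension `m + 2`. -/
noncomputable def radialWeight (m : ℕ) (σ r : ℝ) : ℝ :=
  r ^ (m + 1) * Real.exp (-(2 * σ ^ 2)⁻¹ * r ^ 2)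

variable {m : ℕ}

theorem measurable_radialWeight (σ : ℝ) : Measurable (radialWeight m σ) := by
  unfold radialWeight; fun_prop

theorem radialWeight_pos (σ : ℝ) {r : ℝ} (hr : 0 < r) : 0 < radialWeight m σ r := by
  unfold radialWeight; positivity

theorem ofReal_radialWeight (σ : ℝ) {r : ℝ} (hr : 0 < r) :
    ENNReal.ofReal (radialWeight m σ r) = ENNReal.ofReal (r ^ (m + 1)) *
      ENNReal.ofReal (Real.exp (-(2 * σ ^ 2)⁻¹ * r ^ 2)) :=
  ENNReal.ofReal_mul (by positivity)

/-- The constant is chosen before `u`, so it can be taken out of the later integral over directions.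
-/
theorem lintegral_norm_angle_isotropicGaussian (x μ : EuclideanSpace ℝ (Fin (m + 2))) {σ : ℝ}
    (hσ : 0 < σ) : ∃ c : ℝ, 0 < c ∧ ∀ u : EuclideanSpace ℝ (Fin (m + 2)), ‖u‖ = 1 →
      ∀ F : ℝ × ℝ → ENNReal, Measurable F →
      ∫⁻ z, F (‖z - x‖, InnerProductGeometry.angle u (z - x)) ∂(isotropicGaussian μ σ) =
        ENNReal.ofReal c * ∫⁻ s in Ioi (0 : ℝ), ∫⁻ φ in Ioo 0 Real.pi,
          F (s, φ) * (ENNReal.ofReal (radialWeight m σ s) *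
            ENNReal.ofReal (directionKernel m ((σ ^ 2)⁻¹ • (μ - x)) u s φ)) := by
  obtain ⟨c, hc, h⟩ := lintegral_sub_isotropicGaussian x μ hσ
  refine ⟨c, hc, fun u hu F hF => ?_⟩
  have hm : Measurable fun z : EuclideanSpace ℝ (Fin (m + 2)) =>
      F (‖z‖, InnerProductGeometry.angle u z) := by
    refine hF.comp (Measurable.prodMk (by fun_prop) ?_)
    exact Real.measurable_arccos.comp (by fun_prop)
  rw [h _ hm, lintegral_norm_angle_exp hu _ (F := fun p => F p *
    ENNReal.ofReal (Real.exp (-(2 * σ ^ 2)⁻¹ * p.1 ^ 2))) (by fun_prop)]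
  congr 1
  refine setLIntegral_congr_fun measurableSet_Ioi fun s (hs : 0 < s) => ?_
  refine lintegral_congr fun φ => ?_
  simp only [ofReal_radialWeight σ hs, directionKernel]
  ring

theorem lintegral_polar_isotropicGaussian (x μ : EuclideanSpace ℝ (Fin (m + 2))) {σ : ℝ}
    (hσ : 0 < σ) : ∃ c : ℝ, 0 < c ∧ ∀ G : EuclideanSpace ℝ (Fin (m + 2)) → ENNReal,
      Measurable G → ∫⁻ y, G (y - x) ∂(isotropicGaussian μ σ) =
        ENNReal.ofReal c * ∫⁻ r in Ioi (0 : ℝ), ENNReal.ofReal (radialWeight m σ r) *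
          ∫⁻ u : sphere (0 : EuclideanSpace ℝ (Fin (m + 2))) 1, G (r • u.1) *
            ENNReal.ofReal (Real.exp (r * inner ℝ u.1 ((σ ^ 2)⁻¹ • (μ - x))))
              ∂volume.toSphere := by
  obtain ⟨c, hc, h⟩ := lintegral_sub_isotropicGaussian x μ hσ
  refine ⟨c, hc, fun G hG => ?_⟩
  rw [h G hG, lintegral_eq_lintegral_toSphere volume (by fun_prop)]
  congr 1
  refine setLIntegral_congr_fun measurableSet_Ioi fun r (hr : 0 < r) => ?_
  simp only [finrank_euclideanSpace_fin]
  rw [ofReal_radialWeight σ hr, mul_assoc]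
  congr 1
  rw [← lintegral_const_mul' _ _ ENNReal.ofReal_ne_top]
  refine lintegral_congr fun u => ?_
  have hu : ‖r • u.1‖ = r := by
    rw [norm_smul, norm_eq_of_mem_sphere, mul_one, Real.norm_of_nonneg hr.le]
  rw [hu, real_inner_smul_left]
  ring

/-- By Tonelli the average over `u` moves inside, where it turns direction kernels into
`angleNumerator`. -/
theorem lintegral_sphere_lintegral_angle {a b : EuclideanSpace ℝ (Fin (m + 2))} {r s : ℝ}
    {F : ℝ → ENNReal} (hF : Measurable F) (c : ENNReal) :
    ∫⁻ u : sphere (0 : EuclideanSpace ℝ (Fin (m + 2))) 1, (∫⁻ φ in Ioo 0 Real.pi,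
        F φ * (c * ENNReal.ofReal (directionKernel m b u s φ)) *
        ENNReal.ofReal (Real.exp (r * inner ℝ u.1 a))) ∂volume.toSphere =
    c * ∫⁻ φ in Ioo 0 Real.pi, F φ * ENNReal.ofReal (angleNumerator m a b φ (r, s)) := by
  have hd : Continuous fun p : sphere (0 : EuclideanSpace ℝ (Fin (m + 2))) 1 × ℝ =>
      directionKernel m b p.1.1 s p.2 := by fun_prop
  have hdm := hd.measurable
  have hn : Continuous fun φ : ℝ => angleNumerator m a b φ (r, s) :=
    (continuous_angleNumerator a b).comp (by fun_prop : Continuous fun φ : ℝ => (φ, r, s))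
  have hnm := hn.measurable
  rw [lintegral_lintegral_swap, ← lintegral_const_mul _ (by fun_prop)]
  · refine setLIntegral_congr_fun measurableSet_Ioo fun φ hφ => ?_
    have hc : Continuous fun u : sphere (0 : EuclideanSpace ℝ (Fin (m + 2))) 1 =>
        directionKernel m b u s φ := by fun_prop
    have hcm := hc.measurable
    have hA : Measurable fun u : sphere (0 : EuclideanSpace ℝ (Fin (m + 2))) 1 =>
        ENNReal.ofReal (Real.exp (r * inner ℝ u.1 a)) *
          ENNReal.ofReal (directionKernel m b u s φ) := by fun_prop
    rw [ofReal_angleNumerator a b (Ioo_subset_Icc_self hφ), ← lintegral_const_mul _ hA,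
      ← lintegral_const_mul _ (hA.const_mul _)]
    refine lintegral_congr fun u => ?_
    ring
  · exact Measurable.aemeasurable (Measurable.mul (Measurable.mul (hF.comp measurable_snd)
      (hdm.ennreal_ofReal.const_mul c)) (by fun_prop))

theorem lintegral_sphere_directionKernel {a b : EuclideanSpace ℝ (Fin (m + 2))} {r σ : ℝ}
    {F : ℝ → ℝ → ENNReal} (hF : Measurable (Function.uncurry F)) :
    ∫⁻ u : sphere (0 : EuclideanSpace ℝ (Fin (m + 2))) 1,
      (∫⁻ s in Ioi (0 : ℝ), ∫⁻ φ in Ioo 0 Real.pi,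
        F s φ * (ENNReal.ofReal (radialWeight m σ s) *
          ENNReal.ofReal (directionKernel m b u s φ))) *
        ENNReal.ofReal (Real.exp (r * inner ℝ u.1 a)) ∂volume.toSphere =
    ∫⁻ s in Ioi (0 : ℝ), ENNReal.ofReal (radialWeight m σ s) * ∫⁻ φ in Ioo 0 Real.pi,
      F s φ * ENNReal.ofReal (angleNumerator m a b φ (r, s)) := by
  have hrw := measurable_radialWeight (m := m) σ
  have hd : Measurable fun p : (sphere (0 : EuclideanSpace ℝ (Fin (m + 2))) 1 × ℝ) × ℝ =>
      directionKernel m b p.1.1 p.1.2 p.2 := by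
    have : Continuous fun p : (sphere (0 : EuclideanSpace ℝ (Fin (m + 2))) 1 × ℝ) × ℝ =>
      directionKernel m b p.1.1 p.1.2 p.2 := by fun_prop
    exact this.measurable
  have hm : Measurable fun p : (sphere (0 : EuclideanSpace ℝ (Fin (m + 2))) 1 × ℝ) × ℝ =>
      F p.1.2 p.2 * (ENNReal.ofReal (radialWeight m σ p.1.2) *
          ENNReal.ofReal (directionKernel m b p.1.1 p.1.2 p.2)) *
            ENNReal.ofReal (Real.exp (r * inner ℝ p.1.1.1 a)) := by
    refine Measurable.mul (Measurable.mul (hF.comp (by fun_prop :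
      Measurable fun p : (sphere (0 : EuclideanSpace ℝ (Fin (m + 2))) 1 × ℝ) × ℝ =>
        (p.1.2, p.2))) ?_) (by fun_prop)
    exact Measurable.mul (hrw.comp (by fun_prop)).ennreal_ofReal hd.ennreal_ofReal
  have hm' : Measurable fun p : (sphere (0 : EuclideanSpace ℝ (Fin (m + 2))) 1 × ℝ) × ℝ =>
      F p.1.2 p.2 * (ENNReal.ofReal (radialWeight m σ p.1.2) *
          ENNReal.ofReal (directionKernel m b p.1.1 p.1.2 p.2)) := by
    refine Measurable.mul (hF.comp (by fun_prop :
      Measurable fun p : (sphere (0 : EuclideanSpace ℝ (Fin (m + 2))) 1 × ℝ) × ℝ =>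
        (p.1.2, p.2))) ?_
    exact Measurable.mul (hrw.comp (by fun_prop)).ennreal_ofReal hd.ennreal_ofReal
  calc _ = ∫⁻ u : sphere (0 : EuclideanSpace ℝ (Fin (m + 2))) 1,
      (∫⁻ s in Ioi (0 : ℝ), ∫⁻ φ in Ioo 0 Real.pi,
        F s φ * (ENNReal.ofReal (radialWeight m σ s) *
          ENNReal.ofReal (directionKernel m b u s φ)) *
        ENNReal.ofReal (Real.exp (r * inner ℝ u.1 a))) ∂volume.toSphere := by
        refine lintegral_congr fun u => ?_
        rw [← lintegral_mul_const]
        · refine lintegral_congr fun s => ?_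
          rw [lintegral_mul_const]
          exact hm'.comp (by fun_prop : Measurable fun φ : ℝ => ((u, s), φ))
        · exact (Measurable.lintegral_prod_right' hm').comp
            (by fun_prop : Measurable fun s : ℝ => (u, s))
    _ = ∫⁻ s in Ioi (0 : ℝ), ∫⁻ u : sphere (0 : EuclideanSpace ℝ (Fin (m + 2))) 1,
        (∫⁻ φ in Ioo 0 Real.pi,
        F s φ * (ENNReal.ofReal (radialWeight m σ s) *
          ENNReal.ofReal (directionKernel m b u s φ)) *
        ENNReal.ofReal (Real.exp (r * inner ℝ u.1 a))) ∂volume.toSphere :=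
        lintegral_lintegral_swap (Measurable.lintegral_prod_right' hm).aemeasurable
    _ = _ := by
        refine lintegral_congr fun s => ?_
        exact lintegral_sphere_lintegral_angle (hF.comp measurable_prodMk_left) _

/-- The joint law of the two radii and the angle for independent isotropic Gaussian points. -/
theorem lintegral_lintegral_isotropicGaussian (x μY μZ : EuclideanSpace ℝ (Fin (m + 2))) {σ : ℝ}
    (hσ : 0 < σ) : ∃ c : ℝ, 0 < c ∧ ∀ F : ℝ × ℝ → ℝ → ENNReal,
      Measurable (Function.uncurry F) →
      ∫⁻ y, ∫⁻ z, F (‖y - x‖, ‖z - x‖) (InnerProductGeometry.angle (y - x) (z - x))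
        ∂(isotropicGaussian μZ σ) ∂(isotropicGaussian μY σ) =
      ENNReal.ofReal c * ∫⁻ w in Ioi (0 : ℝ) ×ˢ Ioi (0 : ℝ),
        ENNReal.ofReal (radialWeight m σ w.1 * radialWeight m σ w.2) *
          ∫⁻ φ in Ioo 0 Real.pi, F w φ * ENNReal.ofReal (angleNumerator m
            ((σ ^ 2)⁻¹ • (μY - x)) ((σ ^ 2)⁻¹ • (μZ - x)) φ w) := by
  obtain ⟨c, hc, hY⟩ := lintegral_polar_isotropicGaussian x μY hσ
  obtain ⟨c', hc', hZ⟩ := lintegral_norm_angle_isotropicGaussian x μZ hσ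
  refine ⟨c * c', by positivity, fun F hF => ?_⟩
  have : IsProbabilityMeasure (isotropicGaussian μZ σ) := by
    unfold isotropicGaussian; infer_instance
  set a := (σ ^ 2)⁻¹ • (μY - x)
  set b := (σ ^ 2)⁻¹ • (μZ - x)
  set G : EuclideanSpace ℝ (Fin (m + 2)) → ENNReal := fun y =>
    ∫⁻ z, F (‖y‖, ‖z - x‖) (InnerProductGeometry.angle y (z - x)) ∂(isotropicGaussian μZ σ)
    with hG
  have hGm : Measurable G := by
    refine Measurable.lintegral_prod_right' (f := fun p : EuclideanSpace ℝ (Fin (m + 2)) ×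
      EuclideanSpace ℝ (Fin (m + 2)) =>
        F (‖p.1‖, ‖p.2 - x‖) (InnerProductGeometry.angle p.1 (p.2 - x))) ?_
    refine hF.comp (Measurable.prodMk (by fun_prop) ?_)
    exact Real.measurable_arccos.comp (by fun_prop)
  have hrw := measurable_radialWeight (m := m) σ
  have hnum := (continuous_angleNumerator a b).measurable
  have hinner : Measurable fun w : ℝ × ℝ => ∫⁻ φ in Ioo 0 Real.pi,
      F w φ * ENNReal.ofReal (angleNumerator m a b φ w) := by
    refine Measurable.lintegral_prod_right' (f := fun p : (ℝ × ℝ) × ℝ =>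
      F p.1 p.2 * ENNReal.ofReal (angleNumerator m a b p.2 p.1)) ?_
    exact Measurable.mul hF (hnum.comp measurable_swap).ennreal_ofReal
  have hw : Measurable fun w : ℝ × ℝ =>
      ENNReal.ofReal (radialWeight m σ w.1 * radialWeight m σ w.2) * ∫⁻ φ in Ioo 0 Real.pi,
      F w φ * ENNReal.ofReal (angleNumerator m a b φ w) :=
    Measurable.mul (((hrw.comp measurable_fst).mul (hrw.comp measurable_snd)).ennreal_ofReal)
      hinner
  refine (hY G hGm).trans ?_
  rw [ENNReal.ofReal_mul hc.le, mul_assoc]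
  congr 1
  rw [Measure.volume_eq_prod, ← Measure.prod_restrict, lintegral_prod _ hw.aemeasurable,
    ← lintegral_const_mul _ (Measurable.lintegral_prod_right' hw)]
  refine setLIntegral_congr_fun measurableSet_Ioi fun r (hr : 0 < r) => ?_
  have hFr : Measurable (Function.uncurry fun s φ => F (r, s) φ) :=
    hF.comp (by fun_prop : Measurable fun p : ℝ × ℝ => ((r, p.1), p.2))
  -- With `y - x` replaced by `r • u`, the angle does not see `r`, so the formula around the unit
  -- axis `u` applies.
  have hGu : ∀ u : sphere (0 : EuclideanSpace ℝ (Fin (m + 2))) 1, G (r • u.1) =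
      ENNReal.ofReal c' * ∫⁻ s in Ioi (0 : ℝ), ∫⁻ φ in Ioo 0 Real.pi,
        F (r, s) φ * (ENNReal.ofReal (radialWeight m σ s) *
          ENNReal.ofReal (directionKernel m b u s φ)) := by
    intro u
    have hu : ‖r • u.1‖ = r := by
      rw [norm_smul, norm_eq_of_mem_sphere, mul_one, Real.norm_of_nonneg hr.le]
    simp only [hG, hu, InnerProductGeometry.angle_smul_left_of_pos _ _ hr]
    exact hZ u (norm_eq_of_mem_sphere u) (fun p => F (r, p.1) p.2) hFr
  simp only [hGu, mul_assoc (ENNReal.ofReal c')]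
  rw [lintegral_const_mul', lintegral_sphere_directionKernel hFr, mul_left_comm,
    ← lintegral_const_mul]
  · congr 1
    refine setLIntegral_congr_fun measurableSet_Ioi fun s (hs : 0 < s) => ?_
    simp only [ENNReal.ofReal_mul (radialWeight_pos σ hr).le, mul_assoc]
  · exact hrw.ennreal_ofReal.mul (hinner.comp (by fun_prop : Measurable fun s : ℝ => (r, s)))
  · exact ENNReal.ofReal_ne_top

end JointLaw

/-! ### Identification of the conditional density and the final bounds. -/

section Conclusion

open Set

variable {m : ℕ} {Ω : Type*} [MeasurableSpace Ω] {P : Measure Ω}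
  {x μY μZ : EuclideanSpace ℝ (Fin (m + 2))} {Y Z : Ω → EuclideanSpace ℝ (Fin (m + 2))} {σ : ℝ}

theorem sqrt_add_le_sqrt_add_sqrt {p q : ℝ} (hp : 0 ≤ p) (hq : 0 ≤ q) :
    √(p + q) ≤ √p + √q := by
  refine Real.sqrt_le_iff.2 ⟨by positivity, ?_⟩
  nlinarith [Real.sq_sqrt hp, Real.sq_sqrt hq, mul_nonneg (Real.sqrt_nonneg p) (Real.sqrt_nonneg q)]

/-- Taking all angles, `B = univ`, integrates the numerator to the normaliser and yields the
marginal law of the radii. -/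
theorem map_norm_eq_withDensity {κ : ℝ × ℝ → ENNReal}
    {a b : EuclideanSpace ℝ (Fin (m + 2))} (hY : Measurable Y) (hZ : Measurable Z)
    (h : ∀ (A : Set (ℝ × ℝ)) (B : Set ℝ), MeasurableSet A → MeasurableSet B →
      P {ω | (‖x - Y ω‖, ‖x - Z ω‖) ∈ A ∧ InnerProductGeometry.angle (Y ω - x) (Z ω - x) ∈ B} =
        ∫⁻ w in A, κ w * (∫⁻ φ in B ∩ Icc 0 Real.pi, ENNReal.ofReal (angleNumerator m a b φ w))
            ∂(volume.restrict (Ioi (0 : ℝ) ×ˢ Ioi (0 : ℝ)))) :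
    P.map (fun ω => (‖x - Y ω‖, ‖x - Z ω‖)) =
      (volume.restrict (Ioi (0 : ℝ) ×ˢ Ioi (0 : ℝ))).withDensity
        fun w => κ w * ENNReal.ofReal (angleNormalizer m a b w) := by
  ext A hA
  rw [Measure.map_apply (by fun_prop) hA, withDensity_apply _ hA]
  have := h A univ hA MeasurableSet.univ
  simp only [mem_univ, and_true, univ_inter, ← restrict_Ioo_eq_restrict_Icc,
    lintegral_angleNumerator] at this
  exact this

variable [IsProbabilityMeasure P]

theorem exists_joint_density (hσ : 0 < σ) (hY : Measurable Y) (hZ : Measurable Z)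
    (hYlaw : P.map Y = isotropicGaussian μY σ) (hZlaw : P.map Z = isotropicGaussian μZ σ)
    (hind : IndepFun Y Z P) :
    ∃ κ : ℝ × ℝ → ENNReal, Measurable κ ∧ (∀ w ∈ Ioi (0 : ℝ) ×ˢ Ioi (0 : ℝ), κ w ≠ 0) ∧
      ∀ (A : Set (ℝ × ℝ)) (B : Set ℝ), MeasurableSet A → MeasurableSet B →
      P {ω | (‖x - Y ω‖, ‖x - Z ω‖) ∈ A ∧ InnerProductGeometry.angle (Y ω - x) (Z ω - x) ∈ B} =
        ∫⁻ w in A, κ w * (∫⁻ φ in B ∩ Icc 0 Real.pi, ENNReal.ofReal (angleNumerator m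
          ((σ ^ 2)⁻¹ • (μY - x)) ((σ ^ 2)⁻¹ • (μZ - x)) φ w))
            ∂(volume.restrict (Ioi (0 : ℝ) ×ˢ Ioi (0 : ℝ))) := by
  obtain ⟨c, hc, h⟩ := lintegral_lintegral_isotropicGaussian x μY μZ hσ
  have hrw := measurable_radialWeight (m := m) σ
  have hρ : Measurable fun w : ℝ × ℝ =>
      ENNReal.ofReal (radialWeight m σ w.1 * radialWeight m σ w.2) :=
    ((hrw.comp measurable_fst).mul (hrw.comp measurable_snd)).ennreal_ofReal
  refine ⟨fun w => ENNReal.ofReal c *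
    ENNReal.ofReal (radialWeight m σ w.1 * radialWeight m σ w.2), hρ.const_mul _, ?_, ?_⟩
  · rintro w ⟨h1, h2⟩
    have := mul_pos (radialWeight_pos (m := m) σ h1) (radialWeight_pos (m := m) σ h2)
    simp [hc, this]
  intro A B hA hB
  set a := (σ ^ 2)⁻¹ • (μY - x)
  set b := (σ ^ 2)⁻¹ • (μZ - x)
  have hang : Measurable fun p : EuclideanSpace ℝ (Fin (m + 2)) ×
      EuclideanSpace ℝ (Fin (m + 2)) => InnerProductGeometry.angle (p.1 - x) (p.2 - x) :=
    Real.measurable_arccos.comp (by fun_prop)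
  set S : Set (EuclideanSpace ℝ (Fin (m + 2)) × EuclideanSpace ℝ (Fin (m + 2))) :=
    {p | (‖p.1 - x‖, ‖p.2 - x‖) ∈ A ∧ InnerProductGeometry.angle (p.1 - x) (p.2 - x) ∈ B} with hS
  have hSm : MeasurableSet S := by
    have hn : Measurable fun p : EuclideanSpace ℝ (Fin (m + 2)) ×
        EuclideanSpace ℝ (Fin (m + 2)) => (‖p.1 - x‖, ‖p.2 - x‖) := by fun_prop
    exact (hn hA).inter (hang hB)
  have hF : Measurable (Function.uncurry fun (w : ℝ × ℝ) (φ : ℝ) =>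
      A.indicator (1 : ℝ × ℝ → ENNReal) w * B.indicator (1 : ℝ → ENNReal) φ) :=
    ((measurable_one.indicator hA).comp measurable_fst).mul
      ((measurable_one.indicator hB).comp measurable_snd)
  calc _ = P ((fun ω => (Y ω, Z ω)) ⁻¹' S) := by
        congr 1; ext ω; simp [hS, norm_sub_rev x]
    _ = P.map (fun ω => (Y ω, Z ω)) S := (Measure.map_apply (hY.prodMk hZ) hSm).symm
    _ = ((isotropicGaussian μY σ).prod (isotropicGaussian μZ σ)) S := by
        rw [(indepFun_iff_map_prod_eq_prod_map_map hY.aemeasurable hZ.aemeasurable).1 hind,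
          hYlaw, hZlaw]
    _ = ∫⁻ p, S.indicator 1 p ∂((isotropicGaussian μY σ).prod (isotropicGaussian μZ σ)) :=
        (lintegral_indicator_one hSm).symm
    _ = ∫⁻ y, ∫⁻ z, S.indicator 1 (y, z) ∂(isotropicGaussian μZ σ)
          ∂(isotropicGaussian μY σ) := by
        have : IsProbabilityMeasure (isotropicGaussian μZ σ) := by
          unfold isotropicGaussian; infer_instance
        exact lintegral_prod _ (measurable_one.indicator hSm).aemeasurable
    _ = _ := by
        have e : ∀ y z, S.indicator (fun _ => (1 : ENNReal)) (y, z) =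
            A.indicator (1 : ℝ × ℝ → ENNReal) (‖y - x‖, ‖z - x‖) *
              B.indicator (1 : ℝ → ENNReal) (InnerProductGeometry.angle (y - x) (z - x)) := by
          intro y z
          simp only [indicator, hS, mem_ofPred_eq, Pi.one_apply]
          split_ifs <;> simp_all
        refine (lintegral_congr fun y => lintegral_congr fun z => e y z).trans ?_
        refine (h _ hF).trans ?_
        rw [← lintegral_const_mul' _ _ ENNReal.ofReal_ne_top, ← lintegral_indicator hA]
        refine lintegral_congr fun w => ?_
        by_cases hw : w ∈ A
        · simp only [indicator_of_mem hw, Pi.one_apply, one_mul, mul_assoc]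
          congr 2
          rw [restrict_Ioo_eq_restrict_Icc, ← Measure.restrict_restrict hB,
            ← lintegral_indicator hB]
          refine lintegral_congr fun φ => ?_
          by_cases hφ : φ ∈ B <;> simp [hφ]
        · simp [hw]

/-- The marginal density `κ · angleNormalizer` times the quotient gives back the joint density. It
is nonzero throughout the quadrant, so nonempty open sets are charged, as uniqueness requires. -/
theorem isCondAngleDensity_angleDensity (hσ : 0 < σ) (hY : Measurable Y) (hZ : Measurable Z)
    (hYlaw : P.map Y = isotropicGaussian μY σ) (hZlaw : P.map Z = isotropicGaussian μZ σ)
    (hind : IndepFun Y Z P) :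
    IsCondAngleDensity P x Y Z
      (angleDensity m ((σ ^ 2)⁻¹ • (μY - x)) ((σ ^ 2)⁻¹ • (μZ - x))) ∧
    ∀ U : Set (ℝ × ℝ), IsOpen U → U.Nonempty → U ⊆ Ioi (0 : ℝ) ×ˢ Ioi (0 : ℝ) →
      P.map (fun ω => (‖x - Y ω‖, ‖x - Z ω‖)) U ≠ 0 := by
  obtain ⟨κ, hκm, hκ0, h⟩ := exists_joint_density (x := x) hσ hY hZ hYlaw hZlaw hind
  set a := (σ ^ 2)⁻¹ • (μY - x)
  set b := (σ ^ 2)⁻¹ • (μZ - x)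
  have hmap := map_norm_eq_withDensity hY hZ h
  have hnorm : Measurable fun w => κ w * ENNReal.ofReal (angleNormalizer m a b w) :=
    hκm.mul (continuous_angleNormalizer a b).measurable.ennreal_ofReal
  constructor
  · refine ⟨fun φ hφ w _ => angleDensity_nonneg a b hφ w,
      (continuous_angleDensity a b).continuousOn, fun A B hA hB => ?_⟩
    have hinner : Measurable fun w : ℝ × ℝ =>
        ∫⁻ φ in B ∩ Icc 0 Real.pi, ENNReal.ofReal (angleDensity m a b φ w) :=
      Measurable.lintegral_prod_right' (f := fun p : (ℝ × ℝ) × ℝ =>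
        ENNReal.ofReal (angleDensity m a b p.2 p.1))
        ((continuous_angleDensity a b).measurable.comp measurable_swap).ennreal_ofReal
    rw [h A B hA hB, hmap, setLIntegral_withDensity_eq_setLIntegral_mul _ hnorm hinner hA]
    refine lintegral_congr fun w => ?_
    rw [Pi.mul_apply, mul_assoc, ← lintegral_const_mul' _ _ ENNReal.ofReal_ne_top]
    congr 1
    refine lintegral_congr fun φ => ?_
    have hp := angleNormalizer_pos a b w
    rw [← ENNReal.ofReal_mul hp.le, angleDensity, mul_div_cancel₀ _ hp.ne']
  · intro U hU hUne hUD
    rw [hmap, withDensity_apply _ hU.measurableSet, Measure.restrict_restrict hU.measurableSet,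
      inter_eq_self_of_subset_left hUD]
    refine ((setLIntegral_pos_iff hnorm).2 ?_).ne'
    rw [inter_eq_self_of_subset_right]
    · exact hU.measure_pos volume hUne
    · intro w hw
      have := angleNormalizer_pos a b w
      simp [hκ0 w (hUD hw), this]

theorem IsCondAngleDensity.eq_angleDensity (hσ : 0 < σ) (hY : Measurable Y) (hZ : Measurable Z)
    (hYlaw : P.map Y = isotropicGaussian μY σ) (hZlaw : P.map Z = isotropicGaussian μZ σ)
    (hind : IndepFun Y Z P) {f : ℝ → ℝ × ℝ → ℝ} (hf : IsCondAngleDensity P x Y Z f)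
    {φ : ℝ} (hφ : φ ∈ Icc 0 Real.pi) {r s : ℝ} (hr : 0 < r) (hs : 0 < s) :
    f φ (r, s) = angleDensity m ((σ ^ 2)⁻¹ • (μY - x)) ((σ ^ 2)⁻¹ • (μZ - x)) φ (r, s) := by
  obtain ⟨hg, hpos⟩ := isCondAngleDensity_angleDensity (x := x) hσ hY hZ hYlaw hZlaw hind
  have hD : IsOpen (Ioi (0 : ℝ) ×ˢ Ioi (0 : ℝ)) := isOpen_Ioi.prod isOpen_Ioi
  exact le_antisymm
    (IsContinuousCondDensity.le_of_open_pos Real.pi_pos hD hpos hf hg hφ ⟨hr, hs⟩)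
    (IsContinuousCondDensity.le_of_open_pos Real.pi_pos hD hpos hg hf hφ ⟨hr, hs⟩)

theorem IsCondAngleDensity.le_of_second (hσ : 0 < σ) (hY : Measurable Y) (hZ : Measurable Z)
    (hYlaw : P.map Y = isotropicGaussian μY σ) (hZlaw : P.map Z = isotropicGaussian μZ σ)
    (hind : IndepFun Y Z P) {f : ℝ → ℝ × ℝ → ℝ} (hf : IsCondAngleDensity P x Y Z f)
    {φ : ℝ} (hφ : φ ∈ Icc 0 Real.pi) {r s : ℝ} (hr : 0 < r) (hs : 0 < s) :
    f φ (r, s) ≤ 32 * Real.exp 4 * (√(m + 2 : ℕ) + √(s * ‖x - μZ‖) / σ) := by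
  rw [hf.eq_angleDensity hσ hY hZ hYlaw hZlaw hind hφ hr hs]
  refine (angleDensity_le _ _ hφ hs.le).trans ?_
  have hb : s * ‖(σ ^ 2)⁻¹ • (μZ - x)‖ = s * ‖x - μZ‖ / σ ^ 2 := by
    rw [norm_smul, norm_sub_rev, Real.norm_of_nonneg (by positivity)]
    field_simp
  rw [hb, add_assoc, add_comm]
  have h1 : √((m + 2 : ℝ) + s * ‖x - μZ‖ / σ ^ 2) ≤ √(m + 2 : ℕ) + √(s * ‖x - μZ‖) / σ := by
    push_cast
    refine (sqrt_add_le_sqrt_add_sqrt (by positivity) (by positivity)).trans_eq ?_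
    rw [Real.sqrt_div (by positivity), Real.sqrt_sq hσ.le]
  have h2 := Real.exp_pos 4
  have h3 : 0 ≤ √(m + 2 : ℕ) + √(s * ‖x - μZ‖) / σ := by positivity
  calc _ ≤ Real.exp 4 * (√(m + 2 : ℕ) + √(s * ‖x - μZ‖) / σ) := by gcongr
    -- The factor `exp 4` would suffice; `32` is included so that both bounds share one constant.
    _ ≤ _ := by nlinarith [mul_nonneg h2.le h3]

theorem IsCondAngleDensity.div_sin_le_of_second (hm : 1 ≤ m) (hσ : 0 < σ) (hY : Measurable Y)
    (hZ : Measurable Z)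
    (hYlaw : P.map Y = isotropicGaussian μY σ) (hZlaw : P.map Z = isotropicGaussian μZ σ)
    (hind : IndepFun Y Z P) {f : ℝ → ℝ × ℝ → ℝ} (hf : IsCondAngleDensity P x Y Z f)
    {φ : ℝ} (hφ : φ ∈ Ioo 0 Real.pi) {r s : ℝ} (hr : 0 < r) (hs : 0 < s) :
    f φ (r, s) / Real.sin φ ≤
      32 * Real.exp 4 * (√(m + 2 : ℕ) + s * ‖x - μZ‖ / (σ ^ 2 * √(m + 2 : ℕ))) := by
  -- With `m = n + 1` a power of the sine is available to cancel, and `d = n + 3` matches `√(n + 3)`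
  -- in the kernel bound, so the final comparison is an equality.
  obtain ⟨n, rfl⟩ := Nat.exists_eq_add_of_le' hm
  rw [hf.eq_angleDensity hσ hY hZ hYlaw hZlaw hind (Ioo_subset_Icc_self hφ) hr hs]
  refine (angleDensity_div_sin_le _ _ hφ hs.le).trans_eq ?_
  have hb : s * ‖(σ ^ 2)⁻¹ • (μZ - x)‖ = s * ‖x - μZ‖ / σ ^ 2 := by
    rw [norm_smul, norm_sub_rev, Real.norm_of_nonneg (by positivity)]
    field_simp
  have hc : ((n + 1 + 2 : ℕ) : ℝ) = n + 3 := by push_cast; ring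
  have hq : √((n : ℝ) + 3) ^ 2 = n + 3 := Real.sq_sqrt (by positivity)
  have hq0 : 0 < √((n : ℝ) + 3) := Real.sqrt_pos.2 (by positivity)
  rw [hb, hc]
  congr 1
  field_simp
  rw [hq]; ring

end Conclusion

theorem mainTheorem4 :
    ∃ C : ℝ, 0 < C ∧
      ∀ (d : ℕ), 2 ≤ d →
      ∀ (x μY μZ : EuclideanSpace ℝ (Fin d)) (σ : ℝ), 0 < σ →
      ∀ {Ω : Type*} [MeasurableSpace Ω] (P : Measure Ω) [IsProbabilityMeasure P]
        (Y Z : Ω → EuclideanSpace ℝ (Fin d)), Measurable Y → Measurable Z →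
        P.map Y = isotropicGaussian μY σ → P.map Z = isotropicGaussian μZ σ →
        IndepFun Y Z P →
        (∃ f : ℝ → ℝ × ℝ → ℝ, IsCondAngleDensity P x Y Z f) ∧
        ∀ f : ℝ → ℝ × ℝ → ℝ, IsCondAngleDensity P x Y Z f →
          ∀ r s : ℝ, 0 < r → 0 < s →
            (∀ φ ∈ Set.Icc 0 Real.pi,
              f φ (r, s) ≤ C * (Real.sqrt d +
                Real.sqrt (min (r * ‖x - μY‖) (s * ‖x - μZ‖)) / σ)) ∧
            (3 ≤ d → ∀ φ ∈ Set.Ioo 0 Real.pi,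
              f φ (r, s) / Real.sin φ ≤ C * (Real.sqrt d +
                min (r * ‖x - μY‖) (s * ‖x - μZ‖) / (σ ^ 2 * Real.sqrt d))) := by
  refine ⟨32 * Real.exp 4, by positivity, ?_⟩
  intro d hd x μY μZ σ hσ Ω _ P _ Y Z hY hZ hYlaw hZlaw hind
  obtain ⟨m, rfl⟩ := Nat.exists_eq_add_of_le' hd
  refine ⟨⟨_, (isCondAngleDensity_angleDensity hσ hY hZ hYlaw hZlaw hind).1⟩, ?_⟩
  intro f hf r s hr hs
  -- The bounds involve only the second point; the exchanged density supplies those in `r ‖x - μY‖`.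
  have hf' := hf.swap hY hZ
  refine ⟨fun φ hφ => ?_, fun h3 φ hφ => ?_⟩
  · rcases min_choice (r * ‖x - μY‖) (s * ‖x - μZ‖) with h | h <;> rw [h]
    · exact hf'.le_of_second hσ hZ hY hZlaw hYlaw hind.symm hφ hs hr
    · exact hf.le_of_second hσ hY hZ hYlaw hZlaw hind hφ hr hs
  · have hm : 1 ≤ m := by omega
    rcases min_choice (r * ‖x - μY‖) (s * ‖x - μZ‖) with h | h <;> rw [h]
    · exact hf'.div_sin_le_of_second hm hσ hZ hY hZlaw hYlaw hind.symm hφ hs hr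
    · exact hf.div_sin_le_of_second hm hσ hY hZ hYlaw hZlaw hind hφ hr hs
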